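/- All Banach spaces are real. Let $(\Omega,\Sigma,\mu)$ be a nonatomic probability space (every set in $\Sigma$ of positive measure contains a set in $\Sigma$ of strictly smaller positive measure), let $L_1=L_1(\Omega,\Sigma,\mu)$ be the space of real integrable functions, and let $X$ be a Banach space. Operators are bounded and linear. For a finite measure space $(A,\mathcal F,\nu)$ and $B\in\mathcal F$ with $\nu(B)>0$, a *sign supported on $B$* is a function $f=\chi_{B_1}-\chi_{B_2}$, where $B_1,B_2\in\mathcal F$ form a partition of $B$ with $\nu(B_1)=\nu(B_2)$. An operator $R\colon L_1(A,\mathcal F,\nu)\to X$ is *PP-narrow* if for every $B\in\mathcal F$ with $\nu(B)>0$ and every $\varepsilon>0$ there is a sign $f\in L_1(A,\mathcal F,\nu)$ supported on $B$ with $\|Rf\|\le\varepsilon$. An operator $T\colon L_1\to X$ is *hereditarily PP-narrow* (*HPP-narrow*) if for every $A\in\Sigma$ with $\mu(A)>0$ and every $\sigma$-algebra $\Sigma_1\subset\Sigma$ of subsets of $A$ such that $(A,\Sigma_1,\mu)$ is nonatomic, the restriction of $T$ to $L_1(A,\Sigma_1,\mu)$ is PP-narrow, where functions on $A$ are extended by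 zero to $\Omega$. **Theorem.** Let $T_n\colon L_1\to X$ ($n=1,2,\dots$) be HPP-narrow operators, and suppose that $\sum_{n=1}^\infty T_n$ converges pointwise unconditionally to an operator $T\colon L_1\to X$, that is, for every $f\in L_1$ the series $\sum_{n=1}^\infty T_nf$ converges unconditionally in $X$ to $Tf$. Then $T$ is HPP-narrow. -/

import Mathlib

open MeasureTheory

/-- A measure is nonatomic if every measurable set of positive measure splits into two measurable
parts of positive measure. (This is about atoms of the measure; Mathlib's `NoAtoms` only says that
points are null sets.) -/
def IsNonatomic {Ω : Type*} [MeasurableSpace Ω] (μ : Measure Ω) : Prop :=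
  ∀ A : Set Ω, MeasurableSet A → 0 < μ A →
    ∃ B : Set Ω, MeasurableSet B ∧ B ⊆ A ∧ 0 < μ B ∧ 0 < μ (A \ B)

/-- `f ∈ L₁(μ)` is a sign supported on `A`: `f = χ_{B₁} - χ_{B₂}` (as elements of `L₁`), where
`B₁` and `B₂` form a partition of `A` into two measurable subsets of equal measure. -/
def IsSignOn {Ω : Type*} [MeasurableSpace Ω] {μ : Measure Ω} (A : Set Ω) (f : Lp ℝ 1 μ) : Prop :=
  ∃ B₁ B₂ : Set Ω, MeasurableSet B₁ ∧ MeasurableSet B₂ ∧ Disjoint B₁ B₂ ∧ B₁ ∪ B₂ = A ∧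
    μ B₁ = μ B₂ ∧
    f =ᵐ[μ] fun ω => B₁.indicator (fun _ => (1 : ℝ)) ω - B₂.indicator (fun _ => (1 : ℝ)) ω

/-- A bounded linear operator on `L₁(μ)` is PP-narrow if every measurable set of positive measure
supports signs on which the operator is arbitrarily small. -/
def IsPPNarrow {Ω X : Type*} [MeasurableSpace Ω] {μ : Measure Ω}
    [NormedAddCommGroup X] [NormedSpace ℝ X] (T : Lp ℝ 1 μ →L[ℝ] X) : Prop :=
  ∀ A : Set Ω, MeasurableSet A → 0 < μ A → ∀ ε : ℝ, 0 < ε →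
    ∃ f : Lp ℝ 1 μ, IsSignOn A f ∧ ‖T f‖ ≤ ε

section Restriction

/-- The restriction of `μ` to the measurable subsets of `A`, as a measure on the type `A`. -/
noncomputable abbrev subtypeMeasure {Ω : Type*} [MeasurableSpace Ω] (μ : Measure Ω) (A : Set Ω) :
    Measure A :=
  μ.comap (Subtype.val : A → Ω)

/-- The restriction of `μ` to a σ-algebra `m` on the subset `A`, consisting of measurable subsets
of `A`. -/
noncomputable def measureOn {Ω : Type*} [MeasurableSpace Ω] (μ : Measure Ω) {A : Set Ω}
    (m : MeasurableSpace A) (hm : m ≤ Subtype.instMeasurableSpace) : @Measure A m :=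
  (subtypeMeasure μ A).trim hm

theorem extend_eq_indicator {Ω : Type*} {A : Set Ω} (f : A → ℝ) :
    Function.extend (Subtype.val : A → Ω) f 0 =
      A.indicator (Function.extend (Subtype.val : A → Ω) f 0) := by
  ext ω
  by_cases h : ω ∈ A
  · simp [h]
  · rw [Set.indicator_of_notMem h, Function.extend_apply' _ _ _ (by simpa using h)]
    rfl

variable {Ω : Type*} [MeasurableSpace Ω] {μ : Measure Ω} {A : Set Ω}

theorem eLpNorm_extend_subtype (hA : MeasurableSet A) (f : A → ℝ) :
    eLpNorm (Function.extend (Subtype.val : A → Ω) f 0) 1 μ = eLpNorm f 1 (subtypeMeasure μ A) := by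
  rw [extend_eq_indicator, eLpNorm_indicator_eq_eLpNorm_restrict hA, ← map_comap_subtype_coe hA μ,
    (MeasurableEmbedding.subtype_coe hA).eLpNorm_map_measure,
    Function.extend_comp Subtype.val_injective f 0]

theorem aestronglyMeasurable_extend (hA : MeasurableSet A) {f : A → ℝ}
    (hf : AEStronglyMeasurable f (subtypeMeasure μ A)) :
    AEStronglyMeasurable (Function.extend (Subtype.val : A → Ω) f 0) μ := by
  rw [extend_eq_indicator, aestronglyMeasurable_indicator_iff hA, ← map_comap_subtype_coe hA μ,
    (MeasurableEmbedding.subtype_coe hA).aestronglyMeasurable_map_iff,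
    Function.extend_comp Subtype.val_injective f 0]
  exact hf

theorem extend_ae_congr_subtype (hA : MeasurableSet A) {f g : A → ℝ}
    (h : f =ᵐ[subtypeMeasure μ A] g) :
    Function.extend (Subtype.val : A → Ω) f 0 =ᵐ[μ] Function.extend (Subtype.val : A → Ω) g 0 := by
  have h2 : ∀ᵐ ω ∂(μ.restrict A), Function.extend (Subtype.val : A → Ω) f 0 ω =
      Function.extend (Subtype.val : A → Ω) g 0 ω := by
    rw [← map_comap_subtype_coe hA μ, (MeasurableEmbedding.subtype_coe hA).ae_map_iff]
    filter_upwards [h] with x hx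
    simpa [Subtype.val_injective.extend_apply] using hx
  filter_upwards [(ae_restrict_iff' hA).1 h2] with ω hω
  by_cases h : ω ∈ A
  · exact hω h
  · rw [Function.extend_apply' _ _ _ (by simpa using h),
      Function.extend_apply' _ _ _ (by simpa using h)]

theorem subtypeMeasure_apply (hA : MeasurableSet A) (s : Set A) :
    subtypeMeasure μ A s = μ (Subtype.val '' s) :=
  (MeasurableEmbedding.subtype_coe hA).comap_apply μ s

theorem measureOn_apply (hA : MeasurableSet A) {m : MeasurableSpace A}
    (hm : m ≤ Subtype.instMeasurableSpace) {s : Set A} (hs : MeasurableSet[m] s) :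
    measureOn μ m hm s = μ (Subtype.val '' s) := by
  rw [measureOn, trim_measurableSet_eq hm hs, subtypeMeasure_apply hA]

theorem eLpNorm_extend (hA : MeasurableSet A) {m : MeasurableSpace A}
    (hm : m ≤ Subtype.instMeasurableSpace) {f : A → ℝ}
    (hf : AEStronglyMeasurable[m] f (measureOn μ m hm)) :
    eLpNorm (Function.extend (Subtype.val : A → Ω) f 0) 1 μ = eLpNorm f 1 (measureOn μ m hm) := by
  rw [eLpNorm_extend_subtype hA]
  exact (eLpNorm_trim_ae hm hf).symm

theorem memLp_extend (hA : MeasurableSet A) {m : MeasurableSpace A}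
    (hm : m ≤ Subtype.instMeasurableSpace) {f : A → ℝ}
    (hf : MemLp f 1 (measureOn μ m hm)) :
    MemLp (Function.extend (Subtype.val : A → Ω) f 0) 1 μ :=
  ⟨aestronglyMeasurable_extend hA (aestronglyMeasurable_of_aestronglyMeasurable_trim hm hf.1),
    by rw [eLpNorm_extend hA hm hf.1]; exact hf.2⟩

theorem extend_ae_congr (hA : MeasurableSet A) {m : MeasurableSpace A}
    (hm : m ≤ Subtype.instMeasurableSpace) {f g : A → ℝ} (h : f =ᵐ[measureOn μ m hm] g) :
    Function.extend (Subtype.val : A → Ω) f 0 =ᵐ[μ] Function.extend (Subtype.val : A → Ω) g 0 :=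
  extend_ae_congr_subtype hA (ae_eq_of_ae_eq_trim (hm := hm) h)

/-- The inclusion of `L₁(A, m, μ)` into `L₁(μ)`: a function on `A` is extended by zero. -/
noncomputable def inclusionL1 (μ : Measure Ω) (hA : MeasurableSet A) (m : MeasurableSpace A)
    (hm : m ≤ Subtype.instMeasurableSpace) : Lp ℝ 1 (measureOn μ m hm) →ₗᵢ[ℝ] Lp ℝ 1 μ where
  toFun f := (memLp_extend hA hm (Lp.memLp f)).toLp _
  map_add' f g := by
    rw [← MemLp.toLp_add, MemLp.toLp_eq_toLp_iff]
    refine (extend_ae_congr hA hm (Lp.coeFn_add f g)).trans (Filter.Eventually.of_forall ?_)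
    intro ω
    by_cases h : ω ∈ A
    · lift ω to A using h
      simp
    · simp [Function.extend_apply' _ _ _ (show ¬ ∃ a : A, (a : Ω) = ω by simpa using h)]
  map_smul' c f := by
    rw [RingHom.id_apply, ← MemLp.toLp_const_smul, MemLp.toLp_eq_toLp_iff]
    refine (extend_ae_congr hA hm (Lp.coeFn_smul c f)).trans (Filter.Eventually.of_forall ?_)
    intro ω
    by_cases h : ω ∈ A
    · lift ω to A using h
      simp
    · simp [Function.extend_apply' _ _ _ (show ¬ ∃ a : A, (a : Ω) = ω by simpa using h)]
  norm_map' f := by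
    change ‖(memLp_extend hA hm (Lp.memLp f)).toLp _‖ = ‖f‖
    rw [Lp.norm_toLp, Lp.norm_def, eLpNorm_extend hA hm (Lp.memLp f).1]

end Restriction

/-- A bounded linear operator `T` on `L₁(μ)` is hereditarily PP-narrow if for every measurable set
`A` of positive measure and every σ-algebra `m` on `A` that consists of measurable subsets of `A`
and on which `μ` is nonatomic, the restriction of `T` to `L₁(A, m, μ)` is PP-narrow. -/
def IsHPPNarrow {Ω X : Type*} [MeasurableSpace Ω] {μ : Measure Ω}
    [NormedAddCommGroup X] [NormedSpace ℝ X] (T : Lp ℝ 1 μ →L[ℝ] X) : Prop :=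
  ∀ (A : Set Ω) (hA : MeasurableSet A), 0 < μ A →
    ∀ (m : MeasurableSpace A) (hm : m ≤ Subtype.instMeasurableSpace),
      IsNonatomic (measureOn μ m hm) →
        IsPPNarrow (T ∘L (inclusionL1 μ hA m hm).toContinuousLinearMap)

/-!
Only the set function `s ↦ T χ_s` of an operator `T` matters for narrowness
(`isHPPNarrow_iff_hNarrow`), so the argument runs with finitely additive set functions dominated
by a multiple of `μ`, and with dyadic trees of sets, in which every set is halved by its two
children. The nodes are words in two letters, and `χ_{A(true l)} - χ_{A(false l)}` is the Haar
function at the node `l`.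

Finitely many HPP-narrow operators are small on a common sign (`jointlyHNarrow`). On a tree whose
Haar functions have summably small images under the first `n` operators, these operators are small
on every sign measurable for the σ-algebra of the tree, because such a sign is close in `L₁` to a
step function on the tree, and the Haar coefficients of that function are at most one. That
σ-algebra is nonatomic, so hereditary narrowness of the next operator yields a sign in it. This is
the point where narrowness on sub-σ-algebras is needed.

For the series `S = ∑ T i`, a gliding hump along the branches of a tree produces Haar functions
which are seen only by the operators in consecutive blocks of indices (`exists_isBlockTree`). By
unconditional convergence the finite partial sums of the series are uniformly bounded. Applied to
`2 ^ |L| χ_{A L}`, whose Haar expansion runs along the branch of `L`, the partial sum over any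
selection of blocks is close to the same selection of the terms of the expansion, mapped by `S`.
Hence for a functional `u` of norm at most one the martingale differences of `u ∘ S` are absolutely
summable along every branch, with a bound independent of the branch and of `u`
(`IsBlockTree.pathSum_abs_le`).

A sign on which `S` is small is now the end value of a martingale with values in `[-1, 1]` and
increments of size `1 / N`: a simple random walk on the tree, divided by `N` and stopped at `±1`.
Its image under `S` is at most the bound for the path sums divided by `N`. The part of the tree on
which the walk is still running after many steps has small measure, and there a sign can be chosen
freely (`exists_halving_of_pathSum_le`).
-/

open MeasureTheory

/-! ### Halvings and narrow set functions -/

/-- `μ` has no atoms inside `A` when only the sets of the σ-algebra `m` are considered. Here `m`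
is a σ-algebra on the whole space, of which only the subsets of `A` matter. -/
def NonatomicOn {Ω : Type*} {mΩ : MeasurableSpace Ω} (μ : Measure Ω)
    (m : MeasurableSpace Ω) (A : Set Ω) : Prop :=
  ∀ B : Set Ω, MeasurableSet[m] B → B ⊆ A → 0 < μ B →
    ∃ C : Set Ω, MeasurableSet[m] C ∧ C ⊆ B ∧ 0 < μ C ∧ 0 < μ (B \ C)

/-- `B` and `C` form a partition of `A` into two `m`-measurable sets of equal measure, so that
`χ_B - χ_C` is a sign supported on `A`. -/
structure IsHalving {Ω : Type*} {mΩ : MeasurableSpace Ω} (μ : Measure Ω) (m : MeasurableSpace Ω)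
    (A B C : Set Ω) : Prop where
  left : MeasurableSet[m] B
  right : MeasurableSet[m] C
  disj : Disjoint B C
  union : B ∪ C = A
  meas : μ B = μ C

/-- Hereditary narrowness of a set function `v`, where `v s` stands for the value of an operator
at the indicator of `s`. -/
def HNarrow {Ω X : Type*} {mΩ : MeasurableSpace Ω} [NormedAddCommGroup X] (μ : Measure Ω)
    (v : Set Ω → X) : Prop :=
  ∀ m : MeasurableSpace Ω, m ≤ mΩ → ∀ A : Set Ω, MeasurableSet[m] A → 0 < μ A →
    NonatomicOn μ m A → ∀ ε : ℝ, 0 < ε →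
      ∃ B C : Set Ω, IsHalving μ m A B C ∧ ‖v B - v C‖ ≤ ε

/-- A finitely additive set function dominated by `K` times the measure. -/
structure IsBddAdd {Ω X : Type*} {mΩ : MeasurableSpace Ω} [NormedAddCommGroup X] (μ : Measure Ω)
    (v : Set Ω → X) (K : ℝ) : Prop where
  add : ∀ B C : Set Ω, MeasurableSet B → MeasurableSet C → Disjoint B C → v (B ∪ C) = v B + v C
  bound : ∀ B : Set Ω, MeasurableSet B → ‖v B‖ ≤ K * μ.real B

section Basic

variable {Ω X : Type*} {m m' : MeasurableSpace Ω} {mΩ : MeasurableSpace Ω} {μ : Measure Ω}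
  [NormedAddCommGroup X]

theorem NonatomicOn.mono {A B : Set Ω} (h : NonatomicOn μ m A)
    (hB : B ⊆ A) : NonatomicOn μ m B :=
  fun C hC hCB hpos => h C hC (hCB.trans hB) hpos

theorem IsBddAdd.real [IsFiniteMeasure μ] : IsBddAdd μ (fun s => μ.real s) 1 where
  add B C _ hC hd := measureReal_union hd hC
  bound B _ := by simp [abs_of_nonneg]

theorem IsBddAdd.diff {v : Set Ω → X} {K : ℝ} (hv : IsBddAdd μ v K) {B C : Set Ω}
    (hB : MeasurableSet B) (hC : MeasurableSet C) : v B = v (B ∩ C) + v (B \ C) := by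
  rw [← hv.add _ _ (hB.inter hC) (hB.diff hC) Set.disjoint_sdiff_inter.symm,
    Set.inter_union_sdiff]

theorem IsBddAdd.empty {v : Set Ω → X} {K : ℝ} (hv : IsBddAdd μ v K) : v ∅ = 0 := by
  have := hv.bound ∅ MeasurableSet.empty
  simpa using this

theorem IsBddAdd.norm_sub_le [IsFiniteMeasure μ] {v : Set Ω → X} {K : ℝ} (hv : IsBddAdd μ v K)
    {B C : Set Ω} (hB : MeasurableSet B) (hC : MeasurableSet C) :
    ‖v B - v C‖ ≤ K * μ.real (symmDiff B C) := by
  rw [hv.diff hB hC, hv.diff hC hB, Set.inter_comm C B, add_sub_add_left_eq_sub]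
  have h1 : μ.real (symmDiff B C) = μ.real (B \ C) + μ.real (C \ B) := by
    rw [Set.symmDiff_def, measureReal_union disjoint_sdiff_sdiff (hC.diff hB)]
  rw [h1, mul_add]
  exact (_root_.norm_sub_le _ _).trans
    (add_le_add (hv.bound _ (hB.diff hC)) (hv.bound _ (hC.diff hB)))

theorem IsHalving.subset_left {A B C : Set Ω} (h : IsHalving μ m A B C) :
    B ⊆ A := h.union ▸ Set.subset_union_left

theorem IsHalving.subset_right {A B C : Set Ω}
    (h : IsHalving μ m A B C) : C ⊆ A := h.union ▸ Set.subset_union_right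

theorem IsHalving.measurableSet {A B C : Set Ω}
    (h : IsHalving μ m A B C) : MeasurableSet[m] A := by
  rw [← h.union]; exact MeasurableSet.union h.left h.right

theorem IsHalving.mono (hm : m ≤ m') {A B C : Set Ω}
    (h : IsHalving μ m A B C) : IsHalving μ m' A B C :=
  ⟨hm _ h.left, hm _ h.right, h.disj, h.union, h.meas⟩

theorem IsHalving.real_left [IsFiniteMeasure μ] {A B C : Set Ω}
    (h : IsHalving μ mΩ A B C) : μ.real B = μ.real A / 2 := by
  have h1 := measureReal_union (μ := μ) h.disj h.right
  have h2 : μ.real B = μ.real C := by simp [Measure.real, h.meas]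
  rw [h.union] at h1
  linarith

theorem IsHalving.real_right [IsFiniteMeasure μ] {A B C : Set Ω}
    (h : IsHalving μ mΩ A B C) : μ.real C = μ.real A / 2 := by
  have h2 : μ.real B = μ.real C := by simp [Measure.real, h.meas]
  rw [← h2, h.real_left]

theorem IsHalving.pos [IsFiniteMeasure μ] {A B C : Set Ω}
    (h : IsHalving μ mΩ A B C) (hA : 0 < μ A) : 0 < μ B ∧ 0 < μ C := by
  have h0 : 0 < μ.real A := ENNReal.toReal_pos hA.ne' (measure_ne_top _ _)
  have h1 := h.real_left
  have h2 := h.real_right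
  constructor
  · by_contra hc
    have : μ.real B = 0 := by simp [Measure.real, nonpos_iff_eq_zero.1 (not_lt.1 hc)]
    linarith
  · by_contra hc
    have : μ.real C = 0 := by simp [Measure.real, nonpos_iff_eq_zero.1 (not_lt.1 hc)]
    linarith

end Basic

/-! ### Operators and their set functions -/

section Operators

variable {Ω X : Type*} [mΩ : MeasurableSpace Ω] {μ : Measure Ω} [IsFiniteMeasure μ]
  [NormedAddCommGroup X] [NormedSpace ℝ X]

open Classical in
/-- The indicator function of `s` as an element of `L₁(μ)`, with the value `0` if `s` is not
measurable. -/
noncomputable def indL1 (μ : Measure Ω) [IsFiniteMeasure μ] (s : Set Ω) : Lp ℝ 1 μ :=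
  if h : MeasurableSet s then indicatorConstLp 1 h (measure_ne_top μ s) (1 : ℝ) else 0

theorem indL1_of_measurableSet {s : Set Ω} (h : MeasurableSet s) :
    indL1 μ s = indicatorConstLp 1 h (measure_ne_top μ s) (1 : ℝ) := dif_pos h

theorem coeFn_indL1 {s : Set Ω} (h : MeasurableSet s) :
    indL1 μ s =ᵐ[μ] s.indicator (fun _ => (1 : ℝ)) := by
  rw [indL1_of_measurableSet h]
  exact indicatorConstLp_coeFn

theorem indL1_union {B C : Set Ω} (hB : MeasurableSet B) (hC : MeasurableSet C)
    (h : Disjoint B C) : indL1 μ (B ∪ C) = indL1 μ B + indL1 μ C := by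
  rw [indL1_of_measurableSet hB, indL1_of_measurableSet hC, indL1_of_measurableSet (hB.union hC)]
  exact indicatorConstLp_disjoint_union hB hC (measure_ne_top μ B) (measure_ne_top μ C)
    h 1

theorem norm_indL1 {s : Set Ω} (h : MeasurableSet s) : ‖indL1 μ s‖ = μ.real s := by
  rw [indL1_of_measurableSet h, norm_indicatorConstLp (by simp) (by simp)]
  simp

theorem isBddAdd_operator (T : Lp ℝ 1 μ →L[ℝ] X) :
    IsBddAdd μ (fun s => T (indL1 μ s)) ‖T‖ where
  add B C hB hC h := by simp only [indL1_union hB hC h, map_add]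
  bound B hB := by
    rw [← norm_indL1 hB]
    exact T.le_opNorm _

theorem inclusionL1_sign {A : Set Ω} (hA : MeasurableSet A) (m : MeasurableSpace A)
    (hm : m ≤ Subtype.instMeasurableSpace) {B C : Set A} (hB : MeasurableSet[m] B)
    (hC : MeasurableSet[m] C) {f : Lp ℝ 1 (measureOn μ m hm)}
    (hf : f =ᵐ[measureOn μ m hm]
      fun ω => B.indicator (fun _ => (1 : ℝ)) ω - C.indicator (fun _ => (1 : ℝ)) ω) :
    inclusionL1 μ hA m hm f = indL1 μ (Subtype.val '' B) - indL1 μ (Subtype.val '' C) := by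
  have hB' : MeasurableSet (Subtype.val '' B : Set Ω) := hA.subtype_image (hm _ hB)
  have hC' : MeasurableSet (Subtype.val '' C : Set Ω) := hA.subtype_image (hm _ hC)
  refine Lp.ext ?_
  refine (MemLp.coeFn_toLp (memLp_extend hA hm (Lp.memLp f))).trans ?_
  refine (extend_ae_congr hA hm hf).trans ?_
  filter_upwards [Lp.coeFn_sub (indL1 μ (Subtype.val '' B)) (indL1 μ (Subtype.val '' C)),
    coeFn_indL1 (μ := μ) hB', coeFn_indL1 (μ := μ) hC'] with ω h1 h2 h3
  rw [h1, Pi.sub_apply, h2, h3]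
  by_cases h : ω ∈ A
  · lift ω to A using h
    rw [Subtype.val_injective.extend_apply]
    have hind : ∀ D : Set A, (Subtype.val '' D : Set Ω).indicator (fun _ => (1 : ℝ)) ω =
        D.indicator (fun _ => (1 : ℝ)) ω := fun D => by
      by_cases hD : ω ∈ D
      · rw [Set.indicator_of_mem hD, Set.indicator_of_mem (Set.mem_image_of_mem _ hD)]
      · rw [Set.indicator_of_notMem hD, Set.indicator_of_notMem]
        rwa [Subtype.val_injective.mem_set_image]
    rw [hind, hind]
  · rw [Function.extend_apply' _ _ _ (by simpa using h)]
    simp [Set.indicator, h]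

/-- The sub-σ-algebra to which hereditary PP-narrowness is applied is the trace of `m` on `A`. -/
theorem IsHPPNarrow.exists_halving {Ω X : Type*} {m mΩ : MeasurableSpace Ω}
    {μ : Measure Ω} [IsFiniteMeasure μ] [NormedAddCommGroup X] [NormedSpace ℝ X]
    {T : Lp ℝ 1 μ →L[ℝ] X} (h : IsHPPNarrow T) (hm : m ≤ mΩ) {A : Set Ω}
    (hA : MeasurableSet[m] A) (hpos : 0 < μ A) (hna : NonatomicOn μ m A) {ε : ℝ} (hε : 0 < ε) :
    ∃ B C : Set Ω, IsHalving μ m A B C ∧ ‖T (indL1 μ B) - T (indL1 μ C)‖ ≤ ε := by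
  have hm' : m.comap (Subtype.val : A → Ω) ≤ Subtype.instMeasurableSpace :=
    MeasurableSpace.comap_mono hm
  have himg : ∀ B : Set A, MeasurableSet[m.comap (Subtype.val : A → Ω)] B →
      MeasurableSet[m] (Subtype.val '' B) := by
    rintro _ ⟨s, hs, rfl⟩
    rw [Subtype.image_preimage_coe]
    exact MeasurableSet.inter hA hs
  have hna' : @IsNonatomic _ (m.comap (Subtype.val : A → Ω))
      (measureOn μ (m.comap (Subtype.val : A → Ω)) hm') := by
    intro B hB hBpos
    rw [measureOn_apply (hm _ hA) hm' hB] at hBpos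
    obtain ⟨C, hC, hCB, h1, h2⟩ := hna _ (himg B hB) (Subtype.coe_image_subset _ _) hBpos
    have hCA : C ⊆ A := hCB.trans (Subtype.coe_image_subset _ _)
    have hC' : MeasurableSet[m.comap (Subtype.val : A → Ω)] (Subtype.val ⁻¹' C) := ⟨C, hC, rfl⟩
    have hCi : Subtype.val '' (Subtype.val ⁻¹' C : Set A) = C := by
      rw [Subtype.image_preimage_coe, Set.inter_eq_right.2 hCA]
    refine ⟨Subtype.val ⁻¹' C, hC', ?_, ?_, ?_⟩
    · intro x hx
      obtain ⟨y, hy, hyx⟩ := hCB hx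
      rwa [← Subtype.val_injective hyx]
    · rwa [measureOn_apply (hm _ hA) hm' hC', hCi]
    · rw [measureOn_apply (hm _ hA) hm' (MeasurableSet.diff hB hC'),
        Set.image_sdiff Subtype.val_injective, hCi]
      exact h2
  have huniv : Subtype.val '' (Set.univ : Set A) = A := by simp
  have hpos' : 0 < measureOn μ (m.comap (Subtype.val : A → Ω)) hm' Set.univ := by
    rwa [measureOn_apply (hm _ hA) hm' MeasurableSet.univ, huniv]
  obtain ⟨f, ⟨B, C, hB, hC, hd, hu, hme, hf⟩, hfε⟩ := h A (hm _ hA) hpos _ hm' hna' Set.univ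
    MeasurableSet.univ hpos' ε hε
  refine ⟨Subtype.val '' B, Subtype.val '' C, ⟨himg B hB, himg C hC, ?_, ?_, ?_⟩, ?_⟩
  · exact (Set.disjoint_image_iff Subtype.val_injective).2 hd
  · rw [← Set.image_union, hu, huniv]
  · rwa [measureOn_apply (hm _ hA) hm' hB, measureOn_apply (hm _ hA) hm' hC] at hme
  · have := inclusionL1_sign (hm _ hA) _ hm' hB hC hf
    rw [← map_sub, ← this]
    exact hfε

/-- A halving in a σ-algebra `m'` on the whole space gives a sign on `A`, if `m'` consists of the
measurable sets whose trace on `A` belongs to `m`. -/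
theorem HNarrow.exists_sign {Ω X : Type*} {m' mΩ : MeasurableSpace Ω}
    {μ : Measure Ω} [IsFiniteMeasure μ] [NormedAddCommGroup X] [NormedSpace ℝ X]
    {T : Lp ℝ 1 μ →L[ℝ] X} (h : HNarrow μ (fun s => T (indL1 μ s))) {A : Set Ω}
    (hA : MeasurableSet[mΩ] A) {m : MeasurableSpace A}
    (hm : m ≤ @Subtype.instMeasurableSpace Ω (· ∈ A) mΩ) (hna : IsNonatomic (measureOn μ m hm))
    (hle : m' ≤ mΩ) (hm'_iff : ∀ s : Set Ω, MeasurableSet[m'] s ↔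
      MeasurableSet[mΩ] s ∧ MeasurableSet[m] (Subtype.val ⁻¹' s : Set A)) {B : Set A}
    (hB : MeasurableSet[m] B) (hBpos : 0 < measureOn μ m hm B) {ε : ℝ} (hε : 0 < ε) :
    ∃ f : Lp ℝ 1 (measureOn μ m hm), IsSignOn B f ∧ ‖T (inclusionL1 μ hA m hm f)‖ ≤ ε := by
  have himg : ∀ C : Set A, MeasurableSet[m] C → MeasurableSet[m'] (Subtype.val '' C) := by
    intro C hC
    rw [hm'_iff, Set.preimage_image_eq _ Subtype.val_injective]
    exact ⟨hA.subtype_image (hm _ hC), hC⟩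
  have hna' : NonatomicOn μ m' (Subtype.val '' B) := by
    intro C hC hCB hCpos
    have hC2 := ((hm'_iff C).1 hC).2
    have hCA : C ⊆ A := hCB.trans (Subtype.coe_image_subset _ _)
    have hCi : Subtype.val '' (Subtype.val ⁻¹' C : Set A) = C := by
      rw [Subtype.image_preimage_coe, Set.inter_eq_right.2 hCA]
    obtain ⟨D, hD, hDC, h1, h2⟩ := hna _ hC2 (by rwa [measureOn_apply hA hm hC2, hCi])
    refine ⟨Subtype.val '' D, himg D hD, ?_, ?_, ?_⟩
    · rw [← hCi]; exact Set.image_mono hDC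
    · rwa [measureOn_apply hA hm hD] at h1
    · rw [measureOn_apply hA hm (MeasurableSet.diff hC2 hD),
        Set.image_sdiff Subtype.val_injective, hCi] at h2
      exact h2
  rw [measureOn_apply hA hm hB] at hBpos
  obtain ⟨C, D, hCD, hε'⟩ := h m' hle _ (himg B hB) hBpos hna' ε hε
  have hpre : ∀ {E : Set Ω}, E ⊆ Subtype.val '' B →
      Subtype.val '' (Subtype.val ⁻¹' E : Set A) = E := fun {E} hE => by
    rw [Subtype.image_preimage_coe,
      Set.inter_eq_right.2 (hE.trans (Subtype.coe_image_subset _ _))]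
  have hC := ((hm'_iff C).1 hCD.left).2
  have hD := ((hm'_iff D).1 hCD.right).2
  have hfin : IsFiniteMeasure (measureOn μ m hm) := by
    constructor
    rw [measureOn_apply hA hm MeasurableSet.univ]
    exact measure_lt_top _ _
  have hind : ∀ E : Set A, MeasurableSet[m] E →
      MemLp (E.indicator (fun _ => (1 : ℝ))) 1 (measureOn μ m hm) :=
    fun E hE => (memLp_const (1 : ℝ)).indicator hE
  have hmem := (hind _ hC).sub (hind _ hD)
  refine ⟨hmem.toLp _, ⟨_, _, hC, hD, hCD.disj.preimage _, ?_, ?_, hmem.coeFn_toLp⟩, ?_⟩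
  · rw [← Set.preimage_union, hCD.union, Set.preimage_image_eq _ Subtype.val_injective]
  · rw [measureOn_apply hA hm hC, measureOn_apply hA hm hD, hpre hCD.subset_left,
      hpre hCD.subset_right, hCD.meas]
  · have := inclusionL1_sign hA m hm hC hD hmem.coeFn_toLp
    rw [hpre hCD.subset_left, hpre hCD.subset_right] at this
    change ‖T (inclusionL1 μ hA m hm _)‖ ≤ ε
    rw [this, map_sub]
    exact hε'

/-- Hereditary PP-narrowness only concerns the values of the operator at indicators, and the
σ-algebras on subsets may be replaced by σ-algebras on the whole space. -/
theorem isHPPNarrow_iff_hNarrow (T : Lp ℝ 1 μ →L[ℝ] X) :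
    IsHPPNarrow T ↔ HNarrow μ (fun s => T (indL1 μ s)) := by
  constructor
  · intro h m hm A hA hpos hna ε hε
    exact h.exists_halving hm hA hpos hna hε
  · intro h A hA hpos m hm hna B hB hBpos ε hε
    -- The σ-algebra on `Ω` consists of the measurable sets whose trace on `A` belongs to `m`.
    exact h.exists_sign (m' := mΩ ⊓ m.map Subtype.val) hA hm hna inf_le_left
      (fun s => MeasurableSpace.measurableSet_inf) hB hBpos hε

end Operators

/-! ### Words and levels of the binary tree -/

/-- The words of length `k`. New letters are put in front, so that the tail of a word is its
parent in the binary tree. -/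
def wordsOfLength : ℕ → Finset (List Bool)
  | 0 => {[]}
  | k + 1 => (wordsOfLength k).image (List.cons true) ∪ (wordsOfLength k).image (List.cons false)

theorem mem_wordsOfLength {k : ℕ} {l : List Bool} : l ∈ wordsOfLength k ↔ l.length = k := by
  induction k generalizing l with
  | zero => simp [wordsOfLength]
  | succ k ih =>
    cases l with
    | nil => simp [wordsOfLength]
    | cons b l => cases b <;> simp [wordsOfLength, ih]

theorem sum_wordsOfLength_succ {M : Type*} [AddCommMonoid M] (k : ℕ) (F : List Bool → M) :
    ∑ l ∈ wordsOfLength (k + 1), F l =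
      ∑ l ∈ wordsOfLength k, (F (true :: l) + F (false :: l)) := by
  rw [wordsOfLength, Finset.sum_union, Finset.sum_image (by simp), Finset.sum_image (by simp),
    Finset.sum_add_distrib]
  rw [Finset.disjoint_left]
  simp

theorem card_wordsOfLength (k : ℕ) : (wordsOfLength k).card = 2 ^ k := by
  induction k with
  | zero => simp [wordsOfLength]
  | succ k ih =>
    have := sum_wordsOfLength_succ k (fun _ => (1 : ℕ))
    simp only [Finset.sum_const, smul_eq_mul, mul_one, ih] at this
    rw [this, pow_succ]

/-- A labelling of the binary tree can be chosen node by node when every label of a node at every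
depth admits suitable labels for the two children. -/
theorem exists_tree {σ : Type*} {R : ℕ → σ → σ → σ → Prop} (s₀ : σ)
    (h : ∀ k s, ∃ t f, R k s t f) :
    ∃ N : List Bool → σ, N [] = s₀ ∧
      ∀ l, R l.length (N l) (N (true :: l)) (N (false :: l)) := by
  choose t f htf using h
  let N : List Bool → σ := fun l =>
    l.rec s₀ (fun b l s => if b then t l.length s else f l.length s)
  exact ⟨N, rfl, fun l => htf l.length (N l)⟩

/-! ### Dyadic trees of sets -/

/-- Every set of the tree is halved by its two children, all of them in the σ-algebra `m`. -/
def IsDyadicTree {Ω : Type*} {mΩ : MeasurableSpace Ω} (μ : Measure Ω) (m : MeasurableSpace Ω)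
    (A : List Bool → Set Ω) : Prop :=
  ∀ l, IsHalving μ m (A l) (A (true :: l)) (A (false :: l))

section Tree

variable {Ω X : Type*} {m : MeasurableSpace Ω} {mΩ : MeasurableSpace Ω} {μ : Measure Ω}
  [NormedAddCommGroup X] {A : List Bool → Set Ω}

theorem IsDyadicTree.mono (hm : m ≤ mΩ) (h : IsDyadicTree μ m A) : IsDyadicTree μ mΩ A :=
  fun l => (h l).mono hm

theorem IsDyadicTree.measurableSet (h : IsDyadicTree μ m A) (l : List Bool) :
    MeasurableSet[m] (A l) := (h l).measurableSet

theorem IsDyadicTree.cons_subset (h : IsDyadicTree μ m A) (b : Bool) (l : List Bool) :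
    A (b :: l) ⊆ A l := by
  cases b
  · exact (h l).subset_right
  · exact (h l).subset_left

theorem IsDyadicTree.subset_root (h : IsDyadicTree μ m A) (l : List Bool) : A l ⊆ A [] := by
  induction l with
  | nil => exact subset_rfl
  | cons b l ih => exact (h.cons_subset b l).trans ih

theorem IsDyadicTree.disjoint (h : IsDyadicTree μ m A) {l l' : List Bool}
    (hlen : l.length = l'.length) (hne : l ≠ l') : Disjoint (A l) (A l') := by
  induction l generalizing l' with
  | nil => exact absurd (List.length_eq_zero_iff.1 hlen.symm).symm hne
  | cons b l ih =>
    cases l' with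
    | nil => simp at hlen
    | cons b' l' =>
      by_cases hl : l = l'
      · subst hl
        have := (h l).disj
        cases b <;> cases b'
        · exact absurd rfl hne
        · exact this.symm
        · exact this
        · exact absurd rfl hne
      · exact (ih (by simpa using hlen) hl).mono (h.cons_subset b l) (h.cons_subset b' l')

theorem IsBddAdd.tree {v : Set Ω → X} {K : ℝ} (hv : IsBddAdd μ v K) (h : IsDyadicTree μ mΩ A)
    (l : List Bool) : v (A l) = v (A (true :: l)) + v (A (false :: l)) := by
  rw [← hv.add _ _ (h l).left (h l).right (h l).disj, (h l).union]

theorem IsBddAdd.sum_inter {v : Set Ω → X} {K : ℝ} (hv : IsBddAdd μ v K)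
    (h : IsDyadicTree μ mΩ A) {B : Set Ω} (hB : MeasurableSet B) (hBA : B ⊆ A []) (k : ℕ) :
    v B = ∑ l ∈ wordsOfLength k, v (B ∩ A l) := by
  induction k with
  | zero => simp [wordsOfLength, Set.inter_eq_left.2 hBA]
  | succ k ih =>
    rw [ih, sum_wordsOfLength_succ]
    refine Finset.sum_congr rfl fun l _ => ?_
    rw [← hv.add _ _ (hB.inter (h l).left) (hB.inter (h l).right)
      ((h l).disj.mono Set.inter_subset_right Set.inter_subset_right),
      ← Set.inter_union_distrib_left, (h l).union]

/-- `E` is a union of sets of the tree at depth `k`. -/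
def IsElementary (A : List Bool → Set Ω) (k : ℕ) (E : Set Ω) : Prop :=
  E ⊆ A [] ∧ ∀ l : List Bool, l.length = k → A l ⊆ E ∨ Disjoint (A l) E

theorem IsElementary.mono (h : IsDyadicTree μ m A) {k n : ℕ} {E : Set Ω}
    (hE : IsElementary A k E) (hkn : k ≤ n) : IsElementary A n E := by
  induction n, hkn using Nat.le_induction with
  | base => exact hE
  | succ n _ ih =>
    refine ⟨hE.1, fun l hl => ?_⟩
    cases l with
    | nil => simp at hl
    | cons b l =>
      have hs := h.cons_subset b l
      rcases ih.2 l (by simpa using hl) with h1 | h1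
      · exact Or.inl (hs.trans h1)
      · exact Or.inr (h1.mono_left hs)

theorem IsElementary.union {k : ℕ} {E F : Set Ω} (hE : IsElementary A k E)
    (hF : IsElementary A k F) : IsElementary A k (E ∪ F) := by
  refine ⟨Set.union_subset hE.1 hF.1, fun l hl => ?_⟩
  rcases hE.2 l hl with h1 | h1
  · exact Or.inl (h1.trans Set.subset_union_left)
  · rcases hF.2 l hl with h2 | h2
    · exact Or.inl (h2.trans Set.subset_union_right)
    · exact Or.inr (Set.disjoint_union_right.2 ⟨h1, h2⟩)

theorem IsElementary.compl (h : IsDyadicTree μ m A) {k : ℕ} {E : Set Ω}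
    (hE : IsElementary A k E) : IsElementary A k (A [] \ E) := by
  refine ⟨Set.sdiff_subset, fun l hl => ?_⟩
  rcases hE.2 l hl with h1 | h1
  · exact Or.inr (Set.disjoint_sdiff_right.mono_left h1)
  · exact Or.inl (Set.subset_sdiff.2 ⟨h.subset_root l, h1⟩)

theorem IsElementary.tree (h : IsDyadicTree μ m A) (l : List Bool) :
    IsElementary A l.length (A l) := by
  refine ⟨h.subset_root l, fun l' hl' => ?_⟩
  by_cases hne : l' = l
  · exact Or.inl (hne ▸ subset_rfl)
  · exact Or.inr (h.disjoint hl' hne)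

theorem IsElementary.measurableSet (h : IsDyadicTree μ m A) {k : ℕ} {E : Set Ω}
    (hE : IsElementary A k E) : MeasurableSet[m] E := by
  classical
  have huniv : ∀ k, A [] = ⋃ l ∈ wordsOfLength k, A l := by
    intro k
    induction k with
    | zero => simp [wordsOfLength]
    | succ k ih =>
      rw [ih, wordsOfLength, Finset.set_biUnion_union, Finset.set_biUnion_finset_image,
        Finset.set_biUnion_finset_image]
      simp only [← Set.iUnion_union_distrib]
      exact Set.iUnion₂_congr fun l _ => (h l).union.symm
  have : E = ⋃ l ∈ (wordsOfLength k).filter (fun l => A l ⊆ E), A l := by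
    apply Set.Subset.antisymm
    · intro x hx
      have hx' := hE.1 hx
      rw [huniv k, Set.mem_iUnion₂] at hx'
      obtain ⟨l, hl, hxl⟩ := hx'
      rcases hE.2 l (mem_wordsOfLength.1 hl) with h1 | h1
      · exact Set.mem_biUnion (Finset.mem_coe.2 (Finset.mem_filter.2 ⟨hl, h1⟩)) hxl
      · exact absurd hx (Set.disjoint_left.1 h1 hxl)
    · exact Set.iUnion₂_subset fun l hl => (Finset.mem_filter.1 hl).2
  rw [this]
  exact Finset.measurableSet_biUnion _ fun l _ => h.measurableSet l

theorem IsBddAdd.elementary {v : Set Ω → X} {K : ℝ} (hv : IsBddAdd μ v K)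
    [NormedSpace ℝ X] (h : IsDyadicTree μ mΩ A) {k : ℕ} {E : Set Ω} (hE : IsElementary A k E)
    {g : List Bool → ℝ} (h1 : ∀ l, l.length = k → A l ⊆ E → g l = 1)
    (h2 : ∀ l, l.length = k → ¬ A l ⊆ E → g l = -1) :
    v E - v (A [] \ E) = ∑ l ∈ wordsOfLength k, g l • v (A l) := by
  rw [hv.sum_inter h (hE.measurableSet h) hE.1 k, hv.sum_inter h
    ((h.measurableSet []).diff (hE.measurableSet h)) Set.sdiff_subset k,
    ← Finset.sum_sub_distrib]
  refine Finset.sum_congr rfl fun l hl => ?_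
  have hl' := mem_wordsOfLength.1 hl
  by_cases hs : A l ⊆ E
  · rw [h1 l hl' hs, Set.inter_eq_right.2 hs,
      (Set.disjoint_sdiff_left.mono_right hs).inter_eq, hv.empty]
    simp
  · have hd := (hE.2 l hl').resolve_left hs
    rw [h2 l hl' hs, hd.symm.inter_eq, Set.inter_eq_right.2
      (Set.subset_sdiff.2 ⟨h.subset_root l, hd⟩), hv.empty]
    simp

variable [IsFiniteMeasure μ]

theorem IsDyadicTree.measureReal (h : IsDyadicTree μ mΩ A) (l : List Bool) :
    μ.real (A l) = μ.real (A []) / 2 ^ l.length := by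
  induction l with
  | nil => simp
  | cons b l ih =>
    have : μ.real (A (b :: l)) = μ.real (A l) / 2 := by
      cases b
      · exact (h l).real_right
      · exact (h l).real_left
    rw [this, ih, List.length_cons, pow_succ]
    field_simp

/-! ### The σ-algebra of a dyadic tree -/

/-- The sets of `m` whose part in the root of the tree is approximated in measure by unions of
sets of the tree; on the root, this is the completion within `m` of the σ-algebra generated by the
tree, and outside the root it is all of `m`. -/
@[reducible]
def treeSigma (hm : m ≤ mΩ) (h : IsDyadicTree μ m A) : MeasurableSpace Ω where
  MeasurableSet' B := MeasurableSet[m] B ∧ ∀ η : ℝ, 0 < η →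
    ∃ k E, IsElementary A k E ∧ μ.real (symmDiff (B ∩ A []) E) ≤ η
  measurableSet_empty := ⟨@MeasurableSet.empty Ω m, fun η hη => ⟨0, ∅, ⟨by simp, by simp⟩, by
    simpa using hη.le⟩⟩
  measurableSet_compl B := by
    rintro ⟨hB, hap⟩
    refine ⟨@MeasurableSet.compl Ω B m hB, fun η hη => ?_⟩
    obtain ⟨k, E, hE, hle⟩ := hap η hη
    refine ⟨k, A [] \ E, hE.compl h, le_trans (measureReal_mono ?_) hle⟩
    intro x
    simp only [Set.mem_symmDiff, Set.mem_inter_iff, Set.mem_compl_iff, Set.mem_sdiff]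
    tauto
  measurableSet_iUnion f := by
    intro hf
    have hm1 := fun i => (hf i).1
    refine ⟨MeasurableSet.iUnion hm1, fun η hη => ?_⟩
    -- Finite unions inherit the approximation, and they exhaust the countable union.
    have hfin : ∀ n : ℕ, ∀ δ : ℝ, 0 < δ → ∃ k E, IsElementary A k E ∧
        μ.real (symmDiff (Set.accumulate f n ∩ A []) E) ≤ δ := by
      intro n
      induction n with
      | zero =>
        intro δ hδ
        simpa [Set.accumulate_zero_nat] using (hf 0).2 δ hδ
      | succ n ih =>
        intro δ hδ
        obtain ⟨k, E, hE, hle⟩ := ih (δ / 2) (by positivity)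
        obtain ⟨k', E', hE', hle'⟩ := (hf (n + 1)).2 (δ / 2) (by positivity)
        refine ⟨max k k', E ∪ E', (hE.mono h (le_max_left _ _)).union
          (hE'.mono h (le_max_right _ _)), ?_⟩
        have hsub : symmDiff (Set.accumulate f (n + 1) ∩ A []) (E ∪ E') ⊆
            symmDiff (Set.accumulate f n ∩ A []) E ∪ symmDiff (f (n + 1) ∩ A []) E' := by
          rw [Set.accumulate_succ]
          intro x
          simp only [Set.mem_symmDiff, Set.mem_inter_iff, Set.mem_union]
          tauto
        have := (measureReal_mono hsub).trans (measureReal_union_le (μ := μ) _ _)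
        linarith
    have hlim : Filter.Tendsto (fun n => μ.real (Set.accumulate f n)) Filter.atTop
        (nhds (μ.real (⋃ i, f i))) :=
      (ENNReal.tendsto_toReal (measure_ne_top _ _)).comp (tendsto_measure_iUnion_accumulate)
    obtain ⟨n, hn⟩ := (hlim.eventually (lt_mem_nhds
      (show μ.real (⋃ i, f i) - η / 2 < μ.real (⋃ i, f i) by linarith))).exists
    obtain ⟨k, E, hE, hle⟩ := hfin n (η / 2) (by positivity)
    refine ⟨k, E, hE, ?_⟩
    have hacc : MeasurableSet (Set.accumulate f n) :=
      by
      rw [Set.accumulate_def]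
      exact MeasurableSet.biUnion (Set.to_countable _) fun i _ => hm _ (hm1 i)
    have hsubU : Set.accumulate f n ⊆ ⋃ i, f i := Set.accumulate_subset_iUnion n
    have hdiff : μ.real ((⋃ i, f i) \ Set.accumulate f n) =
        μ.real (⋃ i, f i) - μ.real (Set.accumulate f n) := measureReal_sdiff hsubU hacc
    have hsub : symmDiff ((⋃ i, f i) ∩ A []) E ⊆
        symmDiff (Set.accumulate f n ∩ A []) E ∪ ((⋃ i, f i) \ Set.accumulate f n) := by
      intro x
      have := @hsubU x
      simp only [Set.mem_symmDiff, Set.mem_inter_iff, Set.mem_union, Set.mem_sdiff]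
      tauto
    have := (measureReal_mono hsub).trans (measureReal_union_le (μ := μ) _ _)
    linarith

theorem treeSigma_le (hm : m ≤ mΩ) (h : IsDyadicTree μ m A) : treeSigma hm h ≤ m :=
  fun _ hB => hB.1

theorem measurableSet_treeSigma (hm : m ≤ mΩ) (h : IsDyadicTree μ m A) (l : List Bool) :
    MeasurableSet[treeSigma hm h] (A l) :=
  ⟨h.measurableSet l, fun η hη => ⟨_, _, IsElementary.tree h l, by
    simpa [Set.inter_eq_left.2 (h.subset_root l)] using hη.le⟩⟩

theorem nonatomicOn_treeSigma (hm : m ≤ mΩ) (h : IsDyadicTree μ m A) :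
    NonatomicOn μ (treeSigma hm h) (A []) := by
  intro B hB hBA hpos
  have hBm : MeasurableSet B := hm _ (treeSigma_le hm h _ hB)
  have hpos' : 0 < μ.real B := ENNReal.toReal_pos hpos.ne' (measure_ne_top _ _)
  have h' := h.mono hm
  -- Some set of the tree, smaller than `B` in measure, cuts `B` in positive measure.
  obtain ⟨k, hk⟩ : ∃ k : ℕ, μ.real (A []) / 2 ^ k < μ.real B := by
    obtain ⟨k, hk⟩ := pow_unbounded_of_one_lt (μ.real (A []) / μ.real B) one_lt_two
    refine ⟨k, ?_⟩
    rw [div_lt_iff₀ hpos'] at hk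
    rw [div_lt_iff₀ (by positivity)]
    linarith
  have hsum := (IsBddAdd.real (μ := μ)).sum_inter h' hBm hBA k
  obtain ⟨l, hl, hlpos⟩ := Finset.exists_lt_of_sum_lt
    (s := wordsOfLength k) (f := fun _ => (0 : ℝ)) (g := fun l => μ.real (B ∩ A l))
    (by rw [← hsum]; simpa using hpos')
  have hle : μ.real (B ∩ A l) < μ.real B := by
    refine lt_of_le_of_lt (measureReal_mono Set.inter_subset_right) ?_
    rwa [h'.measureReal, mem_wordsOfLength.1 hl]
  refine ⟨B ∩ A l, MeasurableSet.inter hB (measurableSet_treeSigma hm h l),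
    Set.inter_subset_left, ?_, ?_⟩
  · exact (ENNReal.toReal_pos_iff.1 hlpos).1
  · have := measureReal_sdiff (μ := μ) (s₁ := B) (Set.inter_subset_left)
      (hBm.inter (h'.measurableSet l))
    have h2 : 0 < μ.real (B \ (B ∩ A l)) := by rw [this]; linarith
    exact (ENNReal.toReal_pos_iff.1 h2).1

end Tree

/-! ### Narrowness of finitely many set functions at once -/

/-- The first `n` set functions of the sequence `v` are small on a common sign, hereditarily. -/
def JointlyHNarrow {Ω X : Type*} {mΩ : MeasurableSpace Ω} [NormedAddCommGroup X] (μ : Measure Ω)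
    (v : ℕ → Set Ω → X) (n : ℕ) : Prop :=
  ∀ m : MeasurableSpace Ω, m ≤ mΩ → ∀ A : Set Ω, MeasurableSet[m] A → 0 < μ A →
    NonatomicOn μ m A → ∀ ε : ℝ, 0 < ε →
      ∃ B C : Set Ω, IsHalving μ m A B C ∧ ∀ i < n, ‖v i B - v i C‖ ≤ ε

section Joint

variable {Ω X : Type*} {m : MeasurableSpace Ω} {mΩ : MeasurableSpace Ω} {μ : Measure Ω}
  [NormedAddCommGroup X] [NormedSpace ℝ X] {A : List Bool → Set Ω}

theorem IsBddAdd.sum_smul_eq {v : Set Ω → X} {K : ℝ} (hv : IsBddAdd μ v K)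
    (h : IsDyadicTree μ mΩ A) (k : ℕ) (G D : List Bool → ℝ) :
    ∑ l ∈ wordsOfLength k, ((G l + D l) • v (A (true :: l)) + (G l - D l) • v (A (false :: l))) =
      ∑ l ∈ wordsOfLength k, G l • v (A l) +
        ∑ l ∈ wordsOfLength k, D l • (v (A (true :: l)) - v (A (false :: l))) := by
  rw [← Finset.sum_add_distrib]
  refine Finset.sum_congr rfl fun l _ => ?_
  rw [hv.tree h l]
  module

/-- A step function on the tree with values in `[-1, 1]` is mapped close to its mean times the
value at the root, if the differences between siblings are summably small. -/
theorem IsBddAdd.norm_sum_smul_sub_le {v : Set Ω → X} {K : ℝ} (hv : IsBddAdd μ v K)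
    (h : IsDyadicTree μ mΩ A) {ε : ℝ}
    (hd : ∀ l, ‖v (A (true :: l)) - v (A (false :: l))‖ ≤ ε / 4 ^ l.length) (k : ℕ)
    (g : List Bool → ℝ) (hg : ∀ l, |g l| ≤ 1) :
    ‖∑ l ∈ wordsOfLength k, g l • v (A l) - ((∑ l ∈ wordsOfLength k, g l) / 2 ^ k) • v (A [])‖ ≤
      2 * ε * (1 - 1 / 2 ^ k) := by
  induction k generalizing g with
  | zero => simp [wordsOfLength]
  | succ k ih =>
    set G : List Bool → ℝ := fun l => (g (true :: l) + g (false :: l)) / 2 with hG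
    set D : List Bool → ℝ := fun l => (g (true :: l) - g (false :: l)) / 2 with hD
    have hG1 : ∀ l, |G l| ≤ 1 := fun l => by
      have h1 := abs_le.1 (hg (true :: l))
      have h2 := abs_le.1 (hg (false :: l))
      rw [hG, abs_le]; constructor <;> dsimp only <;> linarith
    have hD1 : ∀ l, |D l| ≤ 1 := fun l => by
      have h1 := abs_le.1 (hg (true :: l))
      have h2 := abs_le.1 (hg (false :: l))
      rw [hD, abs_le]; constructor <;> dsimp only <;> linarith
    have e1 : ∑ l ∈ wordsOfLength (k + 1), g l • v (A l) =
        ∑ l ∈ wordsOfLength k, G l • v (A l) +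
          ∑ l ∈ wordsOfLength k, D l • (v (A (true :: l)) - v (A (false :: l))) := by
      rw [← hv.sum_smul_eq h, sum_wordsOfLength_succ]
      refine Finset.sum_congr rfl fun l _ => ?_
      congr 2 <;> simp only [hG, hD] <;> ring
    have e2 : (∑ l ∈ wordsOfLength (k + 1), g l) / 2 ^ (k + 1) =
        (∑ l ∈ wordsOfLength k, G l) / 2 ^ k := by
      rw [sum_wordsOfLength_succ, hG, ← Finset.sum_div, pow_succ]
      field_simp
    have e3 : ‖∑ l ∈ wordsOfLength k, D l • (v (A (true :: l)) - v (A (false :: l)))‖ ≤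
        ε / 2 ^ k := by
      refine (norm_sum_le_of_le (wordsOfLength k) (f := fun l =>
        D l • (v (A (true :: l)) - v (A (false :: l)))) (n := fun _ => ε / 4 ^ k)
        fun l hl => ?_).trans ?_
      · rw [norm_smul, Real.norm_eq_abs, ← mem_wordsOfLength.1 hl]
        exact (mul_le_of_le_one_left (norm_nonneg _) (hD1 l)).trans (hd l)
      · rw [Finset.sum_const, card_wordsOfLength, nsmul_eq_mul]
        have : (4 : ℝ) ^ k = 2 ^ k * 2 ^ k := by rw [← mul_pow]; norm_num
        rw [this]
        push_cast
        apply le_of_eq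
        field_simp
    rw [e1, e2, add_sub_right_comm]
    refine (norm_add_le _ _).trans ((add_le_add (ih G hG1) e3).trans (le_of_eq ?_))
    rw [pow_succ]
    field_simp
    ring

variable [IsFiniteMeasure μ]

/-- A set function with summably small sibling differences on a dyadic tree is small on all signs
that are measurable for the σ-algebra of the tree. -/
theorem IsBddAdd.norm_sub_le_of_treeSigma {v : Set Ω → X} {K : ℝ} (hv : IsBddAdd μ v K)
    (hK : 0 ≤ K) (hm : m ≤ mΩ) (h : IsDyadicTree μ m A) {ε : ℝ} (hε : 0 < ε)
    (hpos : 0 < μ (A []))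
    (hd : ∀ l, ‖v (A (true :: l)) - v (A (false :: l))‖ ≤ ε / 4 ^ l.length) {B C : Set Ω}
    (hBC : IsHalving μ (treeSigma hm h) (A []) B C) : ‖v B - v C‖ ≤ 3 * ε := by
  classical
  have h' := h.mono hm
  have hBC' := hBC.mono ((treeSigma_le hm h).trans hm)
  have hA0 : 0 < μ.real (A []) := ENNReal.toReal_pos hpos.ne' (measure_ne_top _ _)
  set η : ℝ := ε / (4 * (K + 1)) with hη
  have hη0 : 0 < η := by positivity
  obtain ⟨k, E, hE, hle⟩ := hBC.left.2 η hη0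
  rw [Set.inter_eq_left.2 hBC.subset_left] at hle
  have hEm := hE.measurableSet h'
  have hle' : μ.real (symmDiff C (A [] \ E)) ≤ η := by
    refine le_trans (measureReal_mono ?_) hle
    intro x
    have h1 : x ∈ B → x ∉ C := fun hb hc => Set.disjoint_left.1 hBC.disj hb hc
    have h2 : x ∈ A [] ↔ x ∈ B ∨ x ∈ C := by rw [← hBC.union, Set.mem_union]
    simp only [Set.mem_symmDiff, Set.mem_sdiff]
    tauto
  set g : List Bool → ℝ := fun l => if A l ⊆ E then 1 else -1 with hg
  have hg1 : ∀ l : List Bool, l.length = k → A l ⊆ E → g l = 1 := fun l _ hl => by simp [hg, hl]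
  have hg2 : ∀ l : List Bool, l.length = k → ¬ A l ⊆ E → g l = -1 := fun l _ hl => by
    simp [hg, hl]
  -- The mean of the step function is almost that of a sign, namely zero.
  have hmean : |(∑ l ∈ wordsOfLength k, g l) / 2 ^ k| * μ.real (A []) ≤ 2 * η := by
    have hr := IsBddAdd.real (μ := μ)
    have e1 := hr.elementary h' hE hg1 hg2
    have e2 : ∑ l ∈ wordsOfLength k, g l • μ.real (A l) =
        (∑ l ∈ wordsOfLength k, g l) / 2 ^ k * μ.real (A []) := by
      rw [Finset.sum_div, Finset.sum_mul]
      refine Finset.sum_congr rfl fun l hl => ?_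
      rw [h'.measureReal, mem_wordsOfLength.1 hl, smul_eq_mul]
      ring
    have e3 := hr.norm_sub_le hBC'.left hEm
    have e4 := hr.norm_sub_le hBC'.right ((h'.measurableSet []).diff hEm)
    have e5 : μ.real B = μ.real C := by simp [Measure.real, hBC.meas]
    rw [Real.norm_eq_abs, abs_le] at e3 e4
    rw [← abs_of_pos hA0, ← abs_mul, ← e2, ← e1, abs_le]
    constructor <;> linarith [e3.1, e3.2, e4.1, e4.2]
  have b1 := hv.norm_sum_smul_sub_le h' hd k g (fun l => by
    simp only [hg]; split_ifs <;> simp)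
  have b2 : ‖((∑ l ∈ wordsOfLength k, g l) / 2 ^ k) • v (A [])‖ ≤ K * (2 * η) := by
    rw [norm_smul, Real.norm_eq_abs]
    calc _ ≤ |(∑ l ∈ wordsOfLength k, g l) / 2 ^ k| * (K * μ.real (A [])) := by
          gcongr
          exact hv.bound _ (h'.measurableSet [])
      _ = K * (|(∑ l ∈ wordsOfLength k, g l) / 2 ^ k| * μ.real (A [])) := by ring
      _ ≤ K * (2 * η) := by gcongr
  have b3 := (hv.norm_sub_le hBC'.left hEm).trans (mul_le_mul_of_nonneg_left hle hK)
  have b4 := (hv.norm_sub_le hBC'.right ((h'.measurableSet []).diff hEm)).trans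
    (mul_le_mul_of_nonneg_left hle' hK)
  have e0 := hv.elementary h' hE hg1 hg2
  have hKη : K * η ≤ ε / 4 := by
    rw [hη, ← mul_div_assoc, div_le_div_iff₀ (by positivity) (by norm_num)]
    nlinarith
  have h1k : 2 * ε * (1 - 1 / 2 ^ k) ≤ 2 * ε := by
    have : (0 : ℝ) < 1 / 2 ^ k := by positivity
    nlinarith
  set M := (∑ l ∈ wordsOfLength k, g l) / 2 ^ k
  have key : v B - v C = (∑ l ∈ wordsOfLength k, g l • v (A l) - M • v (A [])) + M • v (A []) +
      ((v B - v E) - (v C - v (A [] \ E))) := by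
    rw [← e0]; abel
  rw [key]
  have t1 := norm_add₃_le (a := ∑ l ∈ wordsOfLength k, g l • v (A l) - M • v (A []))
    (b := M • v (A [])) (c := (v B - v E) - (v C - v (A [] \ E)))
  have t2 := _root_.norm_sub_le (v B - v E) (v C - v (A [] \ E))
  linarith

/-- Finitely many hereditarily narrow set functions are jointly narrow: a dyadic tree on which
the first `n` of them are small carries a nonatomic σ-algebra, in which the next one finds a
sign. -/
theorem jointlyHNarrow {v : ℕ → Set Ω → X} {K : ℕ → ℝ} (hv : ∀ i, IsBddAdd μ (v i) (K i))
    (hK : ∀ i, 0 ≤ K i) (hn : ∀ i, HNarrow μ (v i)) (n : ℕ) : JointlyHNarrow μ v n := by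
  induction n with
  | zero =>
    intro m hm A hA hpos hna ε hε
    obtain ⟨B, C, hBC, -⟩ := hn 0 m hm A hA hpos hna ε hε
    exact ⟨B, C, hBC, fun i hi => absurd hi (Nat.not_lt_zero i)⟩
  | succ n ih =>
    intro m hm A hA hpos hna ε hε
    obtain ⟨N, hN0, hN⟩ := exists_tree
      (σ := {B : Set Ω // MeasurableSet[m] B ∧ B ⊆ A ∧ 0 < μ B})
      (R := fun k s t f => IsHalving μ m s.1 t.1 f.1 ∧
        ∀ i < n, ‖v i t.1 - v i f.1‖ ≤ (ε / 3) / 4 ^ k) ⟨A, hA, subset_rfl, hpos⟩ (by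
        rintro k ⟨B, hB, hBA, hBpos⟩
        obtain ⟨C, D, hCD, hle⟩ := ih m hm B hB hBpos (hna.mono hBA) ((ε / 3) / 4 ^ k)
          (by positivity)
        exact ⟨⟨C, hCD.left, hCD.subset_left.trans hBA, ((hCD.mono hm).pos hBpos).1⟩,
          ⟨D, hCD.right, hCD.subset_right.trans hBA, ((hCD.mono hm).pos hBpos).2⟩, hCD, hle⟩)
    have htree : IsDyadicTree μ m (fun l => (N l).1) := fun l => (hN l).1
    have hroot : (N []).1 = A := by rw [hN0]
    obtain ⟨B, C, hBC, hle⟩ := hn n (treeSigma hm htree) ((treeSigma_le hm htree).trans hm)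
      (N []).1 (measurableSet_treeSigma hm htree []) (by rw [hroot]; exact hpos)
      (nonatomicOn_treeSigma hm htree) ε hε
    refine ⟨B, C, by rw [← hroot]; exact hBC.mono (treeSigma_le hm htree), fun i hi => ?_⟩
    rcases Nat.lt_succ_iff_lt_or_eq.1 hi with hi | rfl
    · have := (hv i).norm_sub_le_of_treeSigma (hK i) hm htree (ε := ε / 3) (by positivity)
        (by rw [hroot]; exact hpos) (fun l => (hN l).2 i hi) hBC
      linarith
    · exact hle

end Joint

/-! ### Block trees for an unconditionally convergent series -/

/-- The sum of `f b l` over all edges `b :: l → l` of the tree on the way from a word to the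
root. -/
def pathSum {Y : Type*} [AddCommMonoid Y] (f : Bool → List Bool → Y) : List Bool → Y
  | [] => 0
  | b :: l => pathSum f l + f b l

/-- The sign with which the left-minus-right difference at a node sees the child `b`. -/
def boolSign (b : Bool) : ℝ := if b then 1 else -1

/-- A dyadic tree of sets with an index attached to every node, such that the finite sums of the
`v i` see the difference at a node `l` only through the block of indices between `n l` and the
index of the children: partial sums below `n l` are small on the difference, and sums beyond `n l`
are small on `A l` itself. -/
structure IsBlockTree {Ω X : Type*} {mΩ : MeasurableSpace Ω} [NormedAddCommGroup X]
    (μ : Measure Ω) (m : MeasurableSpace Ω) (v : ℕ → Set Ω → X) (A : List Bool → Set Ω)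
    (n : List Bool → ℕ) : Prop where
  tree : IsDyadicTree μ m A
  le : ∀ b l, n l ≤ n (b :: l)
  children : ∀ l, n (true :: l) = n (false :: l)
  head : ∀ l, ∀ F ⊆ Finset.range (n l),
    ‖∑ i ∈ F, (v i (A (true :: l)) - v i (A (false :: l)))‖ ≤ 1 / 4 ^ l.length
  tail : ∀ l, ∀ F : Finset ℕ, (∀ i ∈ F, n l ≤ i) → ‖∑ i ∈ F, v i (A l)‖ ≤ 1 / 4 ^ l.length

section Tail

variable {X : Type*} [NormedAddCommGroup X]

theorem Summable.exists_norm_sum_le {f : ℕ → X} (hf : Summable f) {η : ℝ} (hη : 0 < η) :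
    ∃ N : ℕ, ∀ F : Finset ℕ, (∀ i ∈ F, N ≤ i) → ‖∑ i ∈ F, f i‖ ≤ η := by
  have hc : CauchySeq fun s : Finset ℕ => ∑ i ∈ s, f i := hf.hasSum.cauchySeq
  obtain ⟨S, hS⟩ := cauchySeq_finset_iff_vanishing_norm.1 hc η hη
  refine ⟨S.sup id + 1, fun F hF => (hS F ?_).le⟩
  rw [Finset.disjoint_left]
  intro i hi hiS
  have h1 := hF i hi
  have h2 := Finset.le_sup (f := id) hiS
  simp only [id] at h2
  omega

theorem HasSum.norm_sub_sum_range_le {f : ℕ → X} {x : X} (hf : HasSum f x) {η : ℝ} {N : ℕ}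
    (h : ∀ F : Finset ℕ, (∀ i ∈ F, N ≤ i) → ‖∑ i ∈ F, f i‖ ≤ η) :
    ‖x - ∑ i ∈ Finset.range N, f i‖ ≤ η := by
  refine le_of_tendsto ((hf.tendsto_sum_nat.sub_const _).norm)
    ((Filter.eventually_ge_atTop N).mono fun k hk => ?_)
  rw [Finset.sum_range_sub_sum_range hk]
  refine h _ fun i hi => ?_
  exact (Finset.mem_filter.1 hi).2

end Tail

section Block

variable {Ω X : Type*} {m : MeasurableSpace Ω} {mΩ : MeasurableSpace Ω} {μ : Measure Ω}
  [NormedAddCommGroup X] {v : ℕ → Set Ω → X}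
  {s : Set Ω → X} {K : ℕ → ℝ} {A : List Bool → Set Ω} {n : List Bool → ℕ}

/-- The gliding hump: joint narrowness of the operators below the current index gives the halving
of a node, and summability at the two halves gives the index of the children. -/
theorem exists_isBlockTree [IsFiniteMeasure μ]
    (hsum : ∀ B, MeasurableSet B → Summable fun i => v i B)
    (hn : ∀ n, JointlyHNarrow μ v n) (hm : m ≤ mΩ) {A₀ : Set Ω} (hA : MeasurableSet[m] A₀)
    (hpos : 0 < μ A₀) (hna : NonatomicOn μ m A₀) :
    ∃ A n, A [] = A₀ ∧ IsBlockTree μ m v A n := by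
  obtain ⟨n₀, hn₀⟩ := (hsum A₀ (hm _ hA)).exists_norm_sum_le one_pos
  obtain ⟨N, hN0, hN⟩ := exists_tree
    (σ := {B : Set Ω // MeasurableSet[m] B ∧ B ⊆ A₀ ∧ 0 < μ B} × ℕ)
    (R := fun k s t f => IsHalving μ m s.1.1 t.1.1 f.1.1 ∧ s.2 ≤ t.2 ∧ t.2 = f.2 ∧
      (∀ F ⊆ Finset.range s.2, ‖∑ i ∈ F, (v i t.1.1 - v i f.1.1)‖ ≤ 1 / 4 ^ k) ∧
      (∀ F : Finset ℕ, (∀ i ∈ F, t.2 ≤ i) → ‖∑ i ∈ F, v i t.1.1‖ ≤ 1 / 4 ^ (k + 1)) ∧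
      (∀ F : Finset ℕ, (∀ i ∈ F, f.2 ≤ i) → ‖∑ i ∈ F, v i f.1.1‖ ≤ 1 / 4 ^ (k + 1)))
    (⟨A₀, hA, subset_rfl, hpos⟩, n₀) (by
      rintro k ⟨⟨B, hB, hBA, hBpos⟩, j⟩
      obtain ⟨C, D, hCD, hle⟩ := hn j m hm B hB hBpos (hna.mono hBA)
        (1 / 4 ^ k / (j + 1)) (by positivity)
      have hη : (0 : ℝ) < 1 / 4 ^ (k + 1) := by positivity
      obtain ⟨j₁, h₁⟩ := (hsum C (hm _ hCD.left)).exists_norm_sum_le hη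
      obtain ⟨j₂, h₂⟩ := (hsum D (hm _ hCD.right)).exists_norm_sum_le hη
      refine ⟨(⟨C, hCD.left, hCD.subset_left.trans hBA, ((hCD.mono hm).pos hBpos).1⟩,
          max j (max j₁ j₂)),
        (⟨D, hCD.right, hCD.subset_right.trans hBA, ((hCD.mono hm).pos hBpos).2⟩,
          max j (max j₁ j₂)), hCD, le_max_left _ _, rfl, fun F hF => ?_, fun F hF => ?_,
          fun F hF => ?_⟩
      · refine (norm_sum_le_of_le F fun i hi => hle i (Finset.mem_range.1 (hF hi))).trans ?_
        rw [Finset.sum_const, nsmul_eq_mul]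
        have hcard : (F.card : ℝ) ≤ j + 1 := by
          have := Finset.card_le_card hF
          rw [Finset.card_range] at this
          have : (F.card : ℝ) ≤ j := by exact_mod_cast this
          linarith
        calc (F.card : ℝ) * (1 / 4 ^ k / (j + 1)) ≤ (j + 1) * (1 / 4 ^ k / (j + 1)) := by gcongr
          _ = 1 / 4 ^ k := by field_simp
      · exact h₁ F fun i hi => ((le_max_left _ _).trans (le_max_right _ _)).trans (hF i hi)
      · exact h₂ F fun i hi => ((le_max_right _ _).trans (le_max_right _ _)).trans (hF i hi))
  refine ⟨fun l => (N l).1.1, fun l => (N l).2, by simp only [hN0], fun l => (hN l).1, ?_,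
    fun l => (hN l).2.2.1, fun l => (hN l).2.2.2.1, ?_⟩
  · rintro (_ | _) l
    · exact (hN l).2.2.1 ▸ (hN l).2.1
    · exact (hN l).2.1
  · rintro (_ | ⟨b, l⟩)
    · rw [hN0]
      simpa using hn₀
    · cases b
      · exact (hN l).2.2.2.2.2
      · exact (hN l).2.2.2.2.1

theorem IsBlockTree.mono (hm : m ≤ mΩ) (h : IsBlockTree μ m v A n) : IsBlockTree μ mΩ v A n :=
  ⟨h.tree.mono hm, h.le, h.children, h.head, h.tail⟩

variable [NormedSpace ℝ X]

/-- Up to a controlled error, any selection from the weighted differences of the sum along a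
branch is the value at `2 ^ |L| χ_{A L}` of a finite sum of the operators: the blocks of indices
belonging to the selected nodes. -/
theorem IsBlockTree.exists_finset (h : IsBlockTree μ mΩ v A n)
    (hv : ∀ i, IsBddAdd μ (v i) (K i))
    (hsum : ∀ B, MeasurableSet B → HasSum (fun i => v i B) (s B))
    (p : Bool → List Bool → Prop) [∀ b l, Decidable (p b l)] (L : List Bool) :
    ∃ E ⊆ Finset.range (n L), ‖(2 : ℝ) ^ L.length • ∑ i ∈ E, v i (A L) -
      pathSum (fun b l => if p b l then
        (boolSign b * 2 ^ l.length) • (s (A (true :: l)) - s (A (false :: l))) else 0) L‖ ≤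
      8 * (1 - 1 / 2 ^ L.length) := by
  induction L with
  | nil => exact ⟨∅, by simp, by simp [pathSum]⟩
  | cons b l ih =>
    obtain ⟨E, hE, hle⟩ := ih
    set Z := pathSum (fun b l => if p b l then
        (boolSign b * 2 ^ l.length) • (s (A (true :: l)) - s (A (false :: l))) else 0) with hZ
    have hZs : Z (b :: l) = Z l + if p b l then
        (boolSign b * 2 ^ l.length) • (s (A (true :: l)) - s (A (false :: l))) else 0 := rfl
    set k := l.length with hk
    set d : ℕ → X := fun i => v i (A (true :: l)) - v i (A (false :: l)) with hd
    set D : X := s (A (true :: l)) - s (A (false :: l)) with hD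
    -- Passing to a child adds one term of the expansion of `2 ^ |L| χ_{A L}`.
    have hchild : ∀ i, (2 : ℝ) ^ (k + 1) • v i (A (b :: l)) =
        (2 : ℝ) ^ k • v i (A l) + (boolSign b * 2 ^ k) • d i := fun i => by
      rw [(hv i).tree h.tree l, hd, pow_succ]
      cases b <;> simp only [boolSign] <;> norm_num <;> module
    have hchildF : ∀ F : Finset ℕ, (2 : ℝ) ^ (k + 1) • ∑ i ∈ F, v i (A (b :: l)) =
        (2 : ℝ) ^ k • ∑ i ∈ F, v i (A l) + (boolSign b * 2 ^ k) • ∑ i ∈ F, d i := fun F => by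
      simp only [Finset.smul_sum, ← Finset.sum_add_distrib, hchild]
    have hsign : ∀ x : X, ‖(boolSign b * 2 ^ k) • x‖ = 2 ^ k * ‖x‖ := fun x => by
      rw [norm_smul]
      cases b <;> simp [boolSign]
    have h4 : (2 : ℝ) ^ k * (1 / 4 ^ k) = 1 / 2 ^ k := by
      have : (4 : ℝ) ^ k = 2 ^ k * 2 ^ k := by rw [← mul_pow]; norm_num
      rw [this]; field_simp
    have hheadE : ‖(boolSign b * 2 ^ k) • ∑ i ∈ E, d i‖ ≤ 1 / 2 ^ k := by
      rw [hsign, ← h4]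
      exact mul_le_mul_of_nonneg_left (h.head l E hE) (by positivity)
    have hstep : 8 * (1 - 1 / (2 : ℝ) ^ (k + 1)) = 8 * (1 - 1 / 2 ^ k) + 4 * (1 / 2 ^ k) := by
      rw [pow_succ]; field_simp; ring
    have hpos : (0 : ℝ) < 1 / 2 ^ k := by positivity
    by_cases hp : p b l
    · set J := Finset.Ico (n l) (n (b :: l)) with hJ
      have hdisj : Disjoint E J := by
        rw [Finset.disjoint_left]
        intro i hi hiJ
        have h1 := Finset.mem_range.1 (hE hi)
        have h2 := (Finset.mem_Ico.1 hiJ).1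
        omega
      refine ⟨E ∪ J, ?_, ?_⟩
      · refine Finset.union_subset (hE.trans (Finset.range_mono (h.le b l))) fun i hi => ?_
        exact Finset.mem_range.2 (Finset.mem_Ico.1 hi).2
      · have hJtail : ‖(2 : ℝ) ^ k • ∑ i ∈ J, v i (A l)‖ ≤ 1 / 2 ^ k := by
          rw [norm_smul, ← h4, norm_pow, Real.norm_ofNat]
          exact mul_le_mul_of_nonneg_left (h.tail l J fun i hi => (Finset.mem_Ico.1 hi).1)
            (by positivity)
        have hrest : ‖D - ∑ i ∈ Finset.range (n (b :: l)), d i‖ ≤ 1 / 4 ^ k := by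
          have t1 := (hsum _ (h.tree.measurableSet (true :: l))).norm_sub_sum_range_le
            (h.tail (true :: l))
          have t2 := (hsum _ (h.tree.measurableSet (false :: l))).norm_sub_sum_range_le
            (h.tail (false :: l))
          have hb : n (true :: l) = n (b :: l) ∧ n (false :: l) = n (b :: l) := by
            cases b
            · exact ⟨h.children l, rfl⟩
            · exact ⟨rfl, (h.children l).symm⟩
          rw [hb.1] at t1
          rw [hb.2] at t2
          rw [hD, hd, Finset.sum_sub_distrib, sub_sub_sub_comm]
          refine (norm_sub_le _ _).trans ((add_le_add t1 t2).trans ?_)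
          simp only [List.length_cons, pow_succ, ← hk]
          have : (0 : ℝ) < 1 / 4 ^ k := by positivity
          have e : (1 : ℝ) / (4 ^ k * 4) = 1 / 4 ^ k / 4 := by rw [div_div]
          rw [e]; linarith
        have hJ' : ‖(boolSign b * 2 ^ k) • (∑ i ∈ J, d i - D)‖ ≤ 2 * (1 / 2 ^ k) := by
          rw [hsign]
          have e : ∑ i ∈ J, d i - D = -(D - ∑ i ∈ Finset.range (n (b :: l)), d i) -
              ∑ i ∈ Finset.range (n l), d i := by
            rw [← Finset.sum_range_add_sum_Ico _ (h.le b l)]; abel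
          have := norm_sub_le (-(D - ∑ i ∈ Finset.range (n (b :: l)), d i))
              (∑ i ∈ Finset.range (n l), d i)
          rw [norm_neg, ← e] at this
          have h' := h.head l _ (Finset.Subset.refl (Finset.range (n l)))
          calc (2 : ℝ) ^ k * ‖∑ i ∈ J, d i - D‖ ≤ 2 ^ k * (1 / 4 ^ k + 1 / 4 ^ k) := by
                gcongr; exact this.trans (add_le_add hrest h')
            _ = 2 * (1 / 2 ^ k) := by rw [mul_add, h4]; ring
        rw [hZs, if_pos hp, List.length_cons, ← hk, hstep, hchildF,
          Finset.sum_union hdisj, Finset.sum_union hdisj]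
        have e : (2 : ℝ) ^ k • (∑ i ∈ E, v i (A l) + ∑ i ∈ J, v i (A l)) +
            (boolSign b * 2 ^ k) • (∑ i ∈ E, d i + ∑ i ∈ J, d i) -
              (Z l + (boolSign b * 2 ^ k) • D) =
            ((2 : ℝ) ^ k • ∑ i ∈ E, v i (A l) - Z l) + (2 : ℝ) ^ k • ∑ i ∈ J, v i (A l) +
              ((boolSign b * 2 ^ k) • ∑ i ∈ E, d i +
                (boolSign b * 2 ^ k) • (∑ i ∈ J, d i - D)) := by
          module
        rw [e]
        refine norm_add₃_le.trans ?_
        have := norm_add_le ((boolSign b * 2 ^ k) • ∑ i ∈ E, d i)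
          ((boolSign b * 2 ^ k) • (∑ i ∈ J, d i - D))
        linarith
    · refine ⟨E, hE.trans (Finset.range_mono (h.le b l)), ?_⟩
      rw [hZs, if_neg hp, List.length_cons, ← hk, hstep, hchildF, add_zero, add_sub_right_comm]
      refine (norm_add_le _ _).trans ?_
      linarith

variable [IsFiniteMeasure μ]

theorem IsBlockTree.norm_pathSum_le (h : IsBlockTree μ mΩ v A n)
    (hv : ∀ i, IsBddAdd μ (v i) (K i))
    (hsum : ∀ B, MeasurableSet B → HasSum (fun i => v i B) (s B))
    {M : ℝ} (hM : ∀ (F : Finset ℕ) (B : Set Ω), MeasurableSet B →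
      ‖∑ i ∈ F, v i B‖ ≤ M * μ.real B)
    (p : Bool → List Bool → Prop) [∀ b l, Decidable (p b l)] (L : List Bool) :
    ‖pathSum (fun b l => if p b l then
        (boolSign b * 2 ^ l.length) • (s (A (true :: l)) - s (A (false :: l))) else 0) L‖ ≤
      M * μ.real (A []) + 8 := by
  obtain ⟨E, -, hE⟩ := h.exists_finset hv hsum p L
  rw [norm_sub_rev] at hE
  have h1 : ‖(2 : ℝ) ^ L.length • ∑ i ∈ E, v i (A L)‖ ≤ M * μ.real (A []) := by
    rw [norm_smul, norm_pow, Real.norm_ofNat]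
    calc (2 : ℝ) ^ L.length * ‖∑ i ∈ E, v i (A L)‖ ≤ 2 ^ L.length * (M * μ.real (A L)) := by
          gcongr; exact hM E _ (h.tree.measurableSet L)
      _ = M * μ.real (A []) := by
          rw [h.tree.measureReal L]; field_simp
  have h2 : 8 * (1 - 1 / (2 : ℝ) ^ L.length) ≤ 8 := by
    have : (0 : ℝ) < 1 / 2 ^ L.length := by positivity
    linarith
  have := norm_le_norm_add_norm_sub' (pathSum (fun b l => if p b l then
        (boolSign b * 2 ^ l.length) • (s (A (true :: l)) - s (A (false :: l))) else 0) L)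
        ((2 : ℝ) ^ L.length • ∑ i ∈ E, v i (A L))
  linarith

/-- Unconditionality on a block tree: for a functional `u` of norm at most one, the martingale
differences of `u ∘ s` are absolutely summable along every branch, with a uniform bound. -/
theorem IsBlockTree.pathSum_abs_le (h : IsBlockTree μ mΩ v A n)
    (hv : ∀ i, IsBddAdd μ (v i) (K i))
    (hsum : ∀ B, MeasurableSet B → HasSum (fun i => v i B) (s B))
    {M : ℝ} (hM : ∀ (F : Finset ℕ) (B : Set Ω), MeasurableSet B →
      ‖∑ i ∈ F, v i B‖ ≤ M * μ.real B) {u : X →L[ℝ] ℝ} (hu : ‖u‖ ≤ 1) (L : List Bool) :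
    pathSum (fun _ l => 2 ^ l.length * |u (s (A (true :: l))) - u (s (A (false :: l)))|) L ≤
      2 * (M * μ.real (A []) + 8) := by
  classical
  -- Select the differences on which the signed functional is nonnegative, and the others.
  set p : Bool → List Bool → Prop := fun b l =>
    0 ≤ boolSign b * (u (s (A (true :: l))) - u (s (A (false :: l)))) with hp
  set q : Bool → List Bool → Prop := fun b l => ¬ p b l with hq
  have h1 := h.norm_pathSum_le hv hsum hM p L
  have h2 := h.norm_pathSum_le hv hsum hM q L
  set P := fun b l => if p b l then
        (boolSign b * 2 ^ l.length) • (s (A (true :: l)) - s (A (false :: l))) else 0 with hP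
  set Q := fun b l => if q b l then
        (boolSign b * 2 ^ l.length) • (s (A (true :: l)) - s (A (false :: l))) else 0 with hQ
  have key : ∀ L : List Bool, pathSum (fun _ l =>
      2 ^ l.length * |u (s (A (true :: l))) - u (s (A (false :: l)))|) L =
      u (pathSum P L) - u (pathSum Q L) := by
    intro L
    induction L with
    | nil => simp [pathSum]
    | cons b l ih =>
      have e : (2 : ℝ) ^ l.length * |u (s (A (true :: l))) - u (s (A (false :: l)))| =
          u (P b l) - u (Q b l) := by
        set x := u (s (A (true :: l))) - u (s (A (false :: l))) with hx
        have hxx : u (s (A (true :: l)) - s (A (false :: l))) = x := by rw [map_sub]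
        have habs : |x| = |boolSign b * x| := by cases b <;> simp [boolSign]
        by_cases hpb : p b l
        · have hq' : ¬ q b l := not_not.2 hpb
          simp only [hP, hQ, if_pos hpb, if_neg hq', map_smul, hxx, map_zero, smul_eq_mul]
          rw [habs, abs_of_nonneg hpb]; ring
        · have hq' : q b l := hpb
          simp only [hP, hQ, if_neg hpb, if_pos hq', map_smul, hxx, map_zero, smul_eq_mul]
          rw [habs, abs_of_neg (not_le.1 hpb)]; ring
      rw [pathSum, pathSum, pathSum, ih, e, map_add, map_add]
      ring
  rw [key]
  have hb : ∀ x : X, |u x| ≤ ‖x‖ := fun x => by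
    have := u.le_of_opNorm_le hu x
    rwa [one_mul] at this
  have h3 := (le_abs_self _).trans ((hb (pathSum P L)).trans h1)
  have h4 := (neg_le_abs _).trans ((hb (pathSum Q L)).trans h2)
  linarith

end Block

/-! ### The stopped random walk -/

/-- The simple random walk on the integers along the letters of a word, starting at `0` and
stopped when it reaches `N` or `-N`. -/
def stoppedWalk (N : ℤ) : List Bool → ℤ
  | [] => 0
  | b :: l => if |stoppedWalk N l| < N then stoppedWalk N l + (if b then 1 else -1)
      else stoppedWalk N l

theorem abs_stoppedWalk_le {N : ℤ} (hN : 0 ≤ N) (l : List Bool) : |stoppedWalk N l| ≤ N := by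
  induction l with
  | nil => simpa [stoppedWalk] using hN
  | cons b l ih =>
    rw [stoppedWalk]
    split_ifs with h1 h2
    · rw [abs_lt] at h1; rw [abs_le]; omega
    · rw [abs_lt] at h1; rw [abs_le]; omega
    · exact ih

theorem stoppedWalk_map_not (N : ℤ) (l : List Bool) :
    stoppedWalk N (l.map not) = -stoppedWalk N l := by
  induction l with
  | nil => simp [stoppedWalk]
  | cons b l ih =>
    simp only [List.map_cons, stoppedWalk, ih, abs_neg]
    cases b <;> split_ifs <;> simp_all <;> ring

theorem sum_wordsOfLength_map_not {M : Type*} [AddCommMonoid M] (k : ℕ) (F : List Bool → M) :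
    ∑ l ∈ wordsOfLength k, F (l.map not) = ∑ l ∈ wordsOfLength k, F l := by
  induction k generalizing F with
  | zero => simp [wordsOfLength]
  | succ k ih =>
    rw [sum_wordsOfLength_succ, sum_wordsOfLength_succ,
      ← ih fun l => F (true :: l) + F (false :: l)]
    refine Finset.sum_congr rfl fun l _ => ?_
    simp [add_comm]

theorem sum_stoppedWalk_odd (N : ℤ) (k : ℕ) {F : ℤ → ℝ} (hF : ∀ x, F (-x) = -F x) :
    ∑ l ∈ wordsOfLength k, F (stoppedWalk N l) = 0 := by
  have := sum_wordsOfLength_map_not k fun l => F (stoppedWalk N l)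
  simp only [stoppedWalk_map_not, hF, Finset.sum_neg_distrib] at this
  linarith

/-- The fraction of words of length `k` along which the walk has not been stopped. -/
noncomputable def runningFraction (N : ℤ) (k : ℕ) : ℝ :=
  (∑ l ∈ wordsOfLength k, if |stoppedWalk N l| < N then (1 : ℝ) else 0) / 2 ^ k

/-- The second moment of the walk grows by `runningFraction N k` in step `k` and remains below
`N ^ 2`. -/
theorem sum_runningFraction_le {N : ℤ} (hN : 0 ≤ N) (k : ℕ) :
    ∑ j ∈ Finset.range k, runningFraction N j ≤ (N : ℝ) ^ 2 := by
  have key : ∀ k, ∑ j ∈ Finset.range k, runningFraction N j =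
      (∑ l ∈ wordsOfLength k, (stoppedWalk N l : ℝ) ^ 2) / 2 ^ k := by
    intro k
    induction k with
    | zero => simp [wordsOfLength, stoppedWalk]
    | succ k ih =>
      rw [Finset.sum_range_succ, ih, runningFraction, ← add_div, ← Finset.sum_add_distrib,
        sum_wordsOfLength_succ, pow_succ, div_eq_div_iff (by positivity) (by positivity),
        ← mul_assoc, mul_right_comm]
      congr 1
      rw [Finset.sum_mul]
      refine Finset.sum_congr rfl fun l _ => ?_
      simp only [stoppedWalk]
      split_ifs <;> push_cast <;> simp_all <;> ring
  rw [key, div_le_iff₀ (by positivity)]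
  calc ∑ l ∈ wordsOfLength k, (stoppedWalk N l : ℝ) ^ 2 ≤ ∑ l ∈ wordsOfLength k, (N : ℝ) ^ 2 := by
        refine Finset.sum_le_sum fun l _ => ?_
        have h : |(stoppedWalk N l : ℝ)| ≤ N := by exact_mod_cast abs_stoppedWalk_le hN l
        exact sq_le_sq' (by linarith [(abs_le.1 h).1]) (abs_le.1 h).2
    _ = (N : ℝ) ^ 2 * 2 ^ k := by
        rw [Finset.sum_const, card_wordsOfLength, nsmul_eq_mul]; push_cast; ring

theorem exists_runningFraction_lt {N : ℤ} (hN : 0 ≤ N) {δ : ℝ} (hδ : 0 < δ) :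
    ∃ k, runningFraction N k < δ := by
  by_contra! hc
  obtain ⟨k, hk⟩ := exists_nat_gt ((N : ℝ) ^ 2 / δ)
  rw [div_lt_iff₀ hδ] at hk
  have h1 := sum_runningFraction_le hN k
  have h2 := Finset.card_nsmul_le_sum (Finset.range k) (runningFraction N) δ fun j _ => hc j
  rw [Finset.card_range, nsmul_eq_mul] at h2
  linarith

/-- The sign obtained from the walk of one step less: where the walk has been stopped at `N` or
`-N` it is the sign of the walk, and on the remaining words it is given by the last letter. -/
def walkSign (N : ℤ) : List Bool → ℝ
  | [] => 1
  | b :: l => if stoppedWalk N l = N then 1 else if stoppedWalk N l = -N then -1 else boolSign b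

theorem walkSign_eq_one_or (N : ℤ) (l : List Bool) : walkSign N l = 1 ∨ walkSign N l = -1 := by
  cases l with
  | nil => exact Or.inl rfl
  | cons b l =>
    rw [walkSign]
    split_ifs
    · exact Or.inl rfl
    · exact Or.inr rfl
    · cases b
      · exact Or.inr rfl
      · exact Or.inl rfl

theorem sum_walkSign {N : ℤ} (hN : 0 < N) (k : ℕ) :
    ∑ l ∈ wordsOfLength (k + 1), walkSign N l = 0 := by
  set F : ℤ → ℝ := fun x => if x = N then 2 else if x = -N then -2 else 0 with hF
  have hFodd : ∀ x, F (-x) = -F x := fun x => by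
    simp only [hF]
    split_ifs <;> first | omega | simp
  rw [sum_wordsOfLength_succ, ← sum_stoppedWalk_odd N k hFodd]
  refine Finset.sum_congr rfl fun l _ => ?_
  simp only [walkSign, hF, boolSign, Bool.false_eq_true, if_true, if_false]
  split_ifs <;> norm_num

theorem abs_walkSign_sub_le {N : ℤ} (hN : 0 < N) (b : Bool) (l : List Bool) :
    |walkSign N (b :: l) - (stoppedWalk N l : ℝ) / N| ≤
      2 * if |stoppedWalk N l| < N then (1 : ℝ) else 0 := by
  have hN' : (0 : ℝ) < N := by exact_mod_cast hN
  by_cases hrun : |stoppedWalk N l| < N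
  · have h1 : |walkSign N (b :: l)| = 1 := by
      rcases walkSign_eq_one_or N (b :: l) with h | h <;> simp [h]
    have h2 : |(stoppedWalk N l : ℝ) / N| ≤ 1 := by
      rw [abs_div, abs_of_pos hN', div_le_one hN']
      exact_mod_cast hrun.le
    rw [if_pos hrun]
    have := abs_sub (walkSign N (b :: l)) ((stoppedWalk N l : ℝ) / N)
    linarith
  · rw [if_neg hrun, walkSign]
    rcases eq_or_eq_neg_of_abs_eq (le_antisymm (abs_stoppedWalk_le hN.le l) (not_lt.1 hrun))
      with hc | hc
    · rw [if_pos hc, hc, div_self hN'.ne']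
      simp
    · rw [if_neg (by omega), if_pos hc, hc]
      push_cast
      rw [neg_div, div_self hN'.ne']
      simp

/-! ### Signs from the stopped walk -/

section Sign

variable {Ω X : Type*} {mΩ : MeasurableSpace Ω} {μ : Measure Ω}
  [NormedAddCommGroup X] [NormedSpace ℝ X] {s : Set Ω → X} {K : ℝ} {A : List Bool → Set Ω}

/-- The martingale of the stopped walk has increments at most one, so a functional sees it within
the average of the path sums of the differences. -/
theorem abs_sum_stoppedWalk_le {w : Set Ω → ℝ} {K : ℝ} (hw : IsBddAdd μ w K)
    (h : IsDyadicTree μ mΩ A) (N : ℤ) (k : ℕ) :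
    |∑ l ∈ wordsOfLength k, (stoppedWalk N l : ℝ) * w (A l)| ≤
      (∑ l ∈ wordsOfLength k,
        pathSum (fun _ l => 2 ^ l.length * |w (A (true :: l)) - w (A (false :: l))|) l) /
          2 ^ k := by
  induction k with
  | zero => simp [wordsOfLength, stoppedWalk, pathSum]
  | succ k ih =>
    set D : List Bool → ℝ := fun l => if |stoppedWalk N l| < N then 1 else 0 with hD
    have e1 : ∑ l ∈ wordsOfLength (k + 1), (stoppedWalk N l : ℝ) * w (A l) =
        ∑ l ∈ wordsOfLength k, (stoppedWalk N l : ℝ) * w (A l) +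
          ∑ l ∈ wordsOfLength k, D l * (w (A (true :: l)) - w (A (false :: l))) := by
      have := hw.sum_smul_eq h k (fun l => (stoppedWalk N l : ℝ)) D
      simp only [smul_eq_mul] at this
      rw [← this, sum_wordsOfLength_succ]
      refine Finset.sum_congr rfl fun l _ => ?_
      simp only [stoppedWalk, hD]
      by_cases hlt : |stoppedWalk N l| < N
      · simp only [if_pos hlt]
        push_cast
        ring
      · simp only [if_neg hlt]
        ring
    have e2 : |∑ l ∈ wordsOfLength k, D l * (w (A (true :: l)) - w (A (false :: l)))| ≤
        ∑ l ∈ wordsOfLength k, |w (A (true :: l)) - w (A (false :: l))| := by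
      refine (Finset.abs_sum_le_sum_abs _ _).trans (Finset.sum_le_sum fun l _ => ?_)
      rw [abs_mul]
      refine mul_le_of_le_one_left (abs_nonneg _) ?_
      simp only [hD]; split_ifs <;> simp
    rw [e1, sum_wordsOfLength_succ]
    refine (abs_add_le _ _).trans ((add_le_add ih e2).trans (le_of_eq ?_))
    simp only [pathSum]
    rw [div_add' _ _ _ (by positivity), pow_succ, div_eq_div_iff (by positivity) (by positivity),
      ← mul_assoc, mul_right_comm]
    congr 1
    rw [Finset.sum_mul, ← Finset.sum_add_distrib, Finset.sum_mul]
    refine Finset.sum_congr rfl fun l hl => ?_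
    rw [mem_wordsOfLength.1 hl]
    ring

/-- The walk takes values up to `N`, but its image is bounded independently of `N`. -/
theorem IsBddAdd.norm_sum_stoppedWalk_le (hs : IsBddAdd μ s K) (h : IsDyadicTree μ mΩ A) {c : ℝ}
    (hc : ∀ u : X →L[ℝ] ℝ, ‖u‖ ≤ 1 → ∀ L, pathSum
      (fun _ l => 2 ^ l.length * |u (s (A (true :: l))) - u (s (A (false :: l)))|) L ≤ c)
    (N : ℤ) (k : ℕ) : ‖∑ l ∈ wordsOfLength k, (stoppedWalk N l : ℝ) • s (A l)‖ ≤ c := by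
  obtain ⟨u, hu, hux⟩ :=
    exists_dual_vector'' ℝ (∑ l ∈ wordsOfLength k, (stoppedWalk N l : ℝ) • s (A l))
  have hus : IsBddAdd μ (fun B => u (s B)) K := by
    refine ⟨fun B C hB hC hd => by rw [hs.add B C hB hC hd, map_add], fun B hB => ?_⟩
    have := u.le_of_opNorm_le hu (s B)
    rw [one_mul] at this
    exact this.trans (hs.bound B hB)
  have h1 := abs_sum_stoppedWalk_le hus h N k
  have h2 : ∑ l ∈ wordsOfLength k, pathSum (fun _ l => (2 : ℝ) ^ l.length *
      |u (s (A (true :: l))) - u (s (A (false :: l)))|) l ≤ c * 2 ^ k := by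
    refine (Finset.sum_le_card_nsmul _ _ c fun l _ => hc u hu l).trans (le_of_eq ?_)
    rw [card_wordsOfLength, nsmul_eq_mul]; push_cast; ring
  have e : u (∑ l ∈ wordsOfLength k, (stoppedWalk N l : ℝ) • s (A l)) =
      ∑ l ∈ wordsOfLength k, (stoppedWalk N l : ℝ) * u (s (A l)) := by
    rw [map_sum]
    exact Finset.sum_congr rfl fun l _ => by rw [map_smul, smul_eq_mul]
  have hux' : u (∑ l ∈ wordsOfLength k, (stoppedWalk N l : ℝ) • s (A l)) =
    ‖∑ l ∈ wordsOfLength k, (stoppedWalk N l : ℝ) • s (A l)‖ := hux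
  rw [← hux', e]
  refine (le_abs_self _).trans (h1.trans ?_)
  rw [div_le_iff₀ (by positivity)]
  exact h2

variable [IsFiniteMeasure μ]

/-- Signs on the words of length `k` come from unions of sets of the tree at depth `k`. -/
theorem IsDyadicTree.exists_isElementary (h : IsDyadicTree μ mΩ A) (hpos : 0 < μ (A [])) (k : ℕ)
    {g : List Bool → ℝ} (hg : ∀ l, g l = 1 ∨ g l = -1) :
    ∃ E, IsElementary A k E ∧ (∀ l : List Bool, l.length = k → A l ⊆ E → g l = 1) ∧
      (∀ l : List Bool, l.length = k → ¬ A l ⊆ E → g l = -1) := by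
  classical
  set E : Set Ω := ⋃ l ∈ (wordsOfLength k).filter (fun l => g l = 1), A l with hE
  have hEsub : ∀ l, l.length = k → g l = 1 → A l ⊆ E := fun l hl hgl =>
    Set.subset_biUnion_of_mem (u := A)
      (Finset.mem_coe.2 (Finset.mem_filter.2 ⟨mem_wordsOfLength.2 hl, hgl⟩))
  have hEdisj : ∀ l, l.length = k → g l = -1 → Disjoint (A l) E := fun l hl hgl => by
    rw [hE, Set.disjoint_iUnion₂_right]
    intro l' hl'
    obtain ⟨h1, h2⟩ := Finset.mem_filter.1 hl'
    refine h.disjoint (by rw [hl, mem_wordsOfLength.1 h1]) ?_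
    rintro rfl
    rw [hgl] at h2; norm_num at h2
  refine ⟨E, ⟨Set.iUnion₂_subset fun l _ => h.subset_root l, fun l hl =>
    (hg l).imp (hEsub l hl) (hEdisj l hl)⟩, fun l hl hle => ?_, fun l hl hle =>
    (hg l).resolve_left fun hgl => hle (hEsub l hl hgl)⟩
  refine (hg l).resolve_right fun hgl => ?_
  have hempty : A l = ∅ := disjoint_self.1 ((hEdisj l hl hgl).mono_right hle)
  have := h.measureReal l
  have ha : 0 < μ.real (A []) := ENNReal.toReal_pos hpos.ne' (measure_ne_top _ _)
  rw [hempty, measureReal_empty] at this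
  have hp : 0 < μ.real (A []) / 2 ^ l.length := by positivity
  linarith

/-- The sign of the walk and the walk divided by `N` only differ where the walk is running. -/
theorem IsBddAdd.norm_sum_walkSign_sub_le (hs : IsBddAdd μ s K) (h : IsDyadicTree μ mΩ A)
    {N : ℤ} (hN : 0 < N) (k : ℕ) :
    ‖∑ l ∈ wordsOfLength (k + 1), walkSign N l • s (A l) -
      (1 / (N : ℝ)) • ∑ l ∈ wordsOfLength k, (stoppedWalk N l : ℝ) • s (A l)‖ ≤
      2 * (K * μ.real (A [])) * runningFraction N k := by
  set r : List Bool → X := fun l =>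
    (walkSign N (true :: l) - (stoppedWalk N l : ℝ) / N) • s (A (true :: l)) +
    (walkSign N (false :: l) - (stoppedWalk N l : ℝ) / N) • s (A (false :: l)) with hr
  have hsplit : ∑ l ∈ wordsOfLength (k + 1), walkSign N l • s (A l) -
      (1 / (N : ℝ)) • ∑ l ∈ wordsOfLength k, (stoppedWalk N l : ℝ) • s (A l) =
      ∑ l ∈ wordsOfLength k, r l := by
    rw [sum_wordsOfLength_succ, Finset.smul_sum, ← Finset.sum_sub_distrib]
    refine Finset.sum_congr rfl fun l _ => ?_
    rw [hs.tree h l, hr]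
    module
  have hrl : ∀ l ∈ wordsOfLength k, ‖r l‖ ≤
      (if |stoppedWalk N l| < N then (1 : ℝ) else 0) * (2 * K * (μ.real (A []) / 2 ^ k)) := by
    intro l hl
    set q : ℝ := if |stoppedWalk N l| < N then (1 : ℝ) else 0 with hq
    have hq0 : 0 ≤ q := by rw [hq]; split_ifs <;> norm_num
    have hterm : ∀ b, ‖(walkSign N (b :: l) - (stoppedWalk N l : ℝ) / N) • s (A (b :: l))‖ ≤
        2 * q * (K * (μ.real (A []) / 2 ^ (k + 1))) := fun b => by
      rw [norm_smul, Real.norm_eq_abs]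
      have hb := hs.bound _ (h.measurableSet (b :: l))
      rw [h.measureReal, List.length_cons, mem_wordsOfLength.1 hl] at hb
      exact mul_le_mul (abs_walkSign_sub_le hN b l) hb (norm_nonneg _) (by positivity)
    refine (norm_add_le _ _).trans ((add_le_add (hterm true) (hterm false)).trans (le_of_eq ?_))
    rw [pow_succ]; field_simp; ring
  rw [hsplit]
  refine (norm_sum_le_of_le _ hrl).trans (le_of_eq ?_)
  rw [← Finset.sum_mul, runningFraction]
  ring

/-- If the path sums of the differences are bounded for all functionals of norm at most one, then
the root of the tree has halvings with arbitrarily small difference: the stopped walk divided by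
`N` has small image and is a sign except on the nodes where the walk is still running, and these
are halved by their children. -/
theorem exists_halving_of_pathSum_le (hs : IsBddAdd μ s K) (hK : 0 ≤ K)
    (h : IsDyadicTree μ mΩ A) (hpos : 0 < μ (A [])) {c : ℝ}
    (hc : ∀ u : X →L[ℝ] ℝ, ‖u‖ ≤ 1 → ∀ L, pathSum
      (fun _ l => 2 ^ l.length * |u (s (A (true :: l))) - u (s (A (false :: l)))|) L ≤ c)
    {ε : ℝ} (hε : 0 < ε) :
    ∃ k E, IsElementary A k E ∧ IsHalving μ mΩ (A []) E (A [] \ E) ∧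
      ‖s E - s (A [] \ E)‖ ≤ ε := by
  -- The walk divided by `N` has small image if `N` is large.
  obtain ⟨N, hN⟩ := exists_nat_gt (max 1 (2 * c / ε))
  have hNpos : (0 : ℝ) < N := by linarith [(le_max_left _ _).trans_lt hN]
  have hcN : c / N ≤ ε / 2 := by
    have := (le_max_right _ _).trans_lt hN
    rw [div_lt_iff₀ hε] at this
    rw [div_le_iff₀ hNpos]
    linarith
  have hNZ : (0 : ℤ) < N := by exact_mod_cast hNpos
  have hKa : 0 ≤ K * μ.real (A []) := mul_nonneg hK measureReal_nonneg
  obtain ⟨k, hk⟩ := exists_runningFraction_lt hNZ.le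
    (show 0 < ε / (4 * (K * μ.real (A []) + 1)) by positivity)
  obtain ⟨E, hE, hg1, hg2⟩ := h.exists_isElementary hpos (k + 1) (walkSign_eq_one_or N)
  have hEm := hE.measurableSet h
  have hreal : μ.real E = μ.real (A [] \ E) := by
    have e1 := (IsBddAdd.real (μ := μ)).elementary h hE hg1 hg2
    have e2 : ∑ l ∈ wordsOfLength (k + 1), walkSign N l • μ.real (A l) =
        (∑ l ∈ wordsOfLength (k + 1), walkSign N l) * (μ.real (A []) / 2 ^ (k + 1)) := by
      rw [Finset.sum_mul]
      refine Finset.sum_congr rfl fun l hl => ?_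
      rw [h.measureReal l, mem_wordsOfLength.1 hl, smul_eq_mul]
    rw [e2, sum_walkSign hNZ, zero_mul] at e1
    linarith
  refine ⟨k + 1, E, hE, ⟨hEm, (h.measurableSet []).diff hEm, Set.disjoint_sdiff_right,
    Set.union_sdiff_cancel hE.1, ?_⟩, ?_⟩
  · exact (measureReal_eq_measureReal_iff (measure_ne_top _ _) (measure_ne_top _ _)).1 hreal
  rw [hs.elementary h hE hg1 hg2]
  have hrest := hs.norm_sum_walkSign_sub_le h hNZ k
  have hwalk : ‖(1 / ((N : ℤ) : ℝ)) •
      ∑ l ∈ wordsOfLength k, (stoppedWalk N l : ℝ) • s (A l)‖ ≤ ε / 2 := by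
    rw [norm_smul, Real.norm_eq_abs, Int.cast_natCast, abs_of_pos (by positivity)]
    refine le_trans (mul_le_mul_of_nonneg_left (hs.norm_sum_stoppedWalk_le h hc N k)
      (by positivity)) ?_
    rwa [one_div_mul_eq_div]
  have hsmall : 2 * (K * μ.real (A [])) * runningFraction N k ≤ ε / 2 := by
    calc _ ≤ 2 * (K * μ.real (A [])) * (ε / (4 * (K * μ.real (A []) + 1))) := by gcongr
      _ ≤ ε / 2 := by
        rw [← mul_div_assoc, div_le_div_iff₀ (by positivity) (by norm_num)]
        nlinarith
  have := norm_le_norm_add_norm_sub' (∑ l ∈ wordsOfLength (k + 1), walkSign N l • s (A l))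
    ((1 / ((N : ℤ) : ℝ)) • ∑ l ∈ wordsOfLength k, (stoppedWalk N l : ℝ) • s (A l))
  linarith

end Sign

/-! ### Series of operators -/

/-- The finite partial sums of a pointwise unconditionally convergent series of operators are
uniformly bounded. -/
theorem exists_norm_sum_le_of_hasSum {E X : Type*} [NormedAddCommGroup E] [NormedSpace ℝ E]
    [CompleteSpace E] [NormedAddCommGroup X] [NormedSpace ℝ X] {T : ℕ → E →L[ℝ] X}
    (h : ∀ f, Summable fun n => T n f) : ∃ M, ∀ F : Finset ℕ, ‖∑ n ∈ F, T n‖ ≤ M := by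
  refine banach_steinhaus fun f => ?_
  obtain ⟨N, hN⟩ := (h f).exists_norm_sum_le one_pos
  refine ⟨∑ n ∈ Finset.range N, ‖T n f‖ + 1, fun F => ?_⟩
  rw [sum_apply, ← Finset.sum_filter_add_sum_filter_not F (· < N)]
  refine (norm_add_le _ _).trans (add_le_add ?_ (hN _ fun i hi => ?_))
  · refine (norm_sum_le _ _).trans (Finset.sum_le_sum_of_subset_of_nonneg (fun i hi => ?_)
      fun _ _ _ => norm_nonneg _)
    exact Finset.mem_range.2 (Finset.mem_filter.1 hi).2
  · exact not_lt.1 (Finset.mem_filter.1 hi).2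

/-- `HasSum` is convergence along the finite subsets of the index set, that is, unconditional
convergence. -/
theorem theorem4p3 {Ω X : Type*} [MeasurableSpace Ω] (μ : Measure Ω) [IsProbabilityMeasure μ]
    (hμ : IsNonatomic μ) [NormedAddCommGroup X] [NormedSpace ℝ X] [CompleteSpace X]
    (T : ℕ → Lp ℝ 1 μ →L[ℝ] X) (S : Lp ℝ 1 μ →L[ℝ] X)
    (hT : ∀ n, IsHPPNarrow (T n))
    (hS : ∀ f : Lp ℝ 1 μ, HasSum (fun n => T n f) (S f)) :
    IsHPPNarrow S := by
  obtain ⟨M, hM⟩ := exists_norm_sum_le_of_hasSum fun f => (hS f).summable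
  have hv : ∀ i, IsBddAdd μ (fun B => T i (indL1 μ B)) ‖T i‖ := fun i => isBddAdd_operator (T i)
  have hjoint : ∀ n, JointlyHNarrow μ (fun i B => T i (indL1 μ B)) n :=
    jointlyHNarrow hv (fun i => norm_nonneg _) fun i => (isHPPNarrow_iff_hNarrow (T i)).1 (hT i)
  have hsum : ∀ B, MeasurableSet B → HasSum (fun i => T i (indL1 μ B)) (S (indL1 μ B)) :=
    fun B _ => hS _
  have hM' : ∀ (F : Finset ℕ) (B : Set Ω), MeasurableSet B →
      ‖∑ i ∈ F, T i (indL1 μ B)‖ ≤ M * μ.real B := fun F B hB => by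
    rw [← sum_apply, ← norm_indL1 hB]
    exact ContinuousLinearMap.le_of_opNorm_le _ (hM F) _
  have hSb := isBddAdd_operator S
  have hsum' := fun B hB => (hsum B hB).summable
  rw [isHPPNarrow_iff_hNarrow]
  intro m hm A₀ hA hpos hna ε hε
  obtain ⟨A, n, hA0, hblock⟩ := exists_isBlockTree hsum' hjoint hm hA hpos hna
  have hblock' := hblock.mono hm
  subst hA0
  obtain ⟨k, E, hE, hhalf, hle⟩ := exists_halving_of_pathSum_le hSb
    (norm_nonneg S) hblock'.tree hpos
    (fun u hu L => hblock'.pathSum_abs_le hv hsum hM' hu L) hε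
  -- The halving consists of unions of sets of the tree, hence of sets of `m`.
  exact ⟨E, A [] \ E, ⟨hE.measurableSet hblock.tree,
    (hE.compl hblock.tree).measurableSet hblock.tree, hhalf.disj, hhalf.union, hhalf.meas⟩, hle⟩
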